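/- Let $M$ be a smooth $m$-dimensional manifold with a Jacobi structure $(\Lambda,E)$: a smooth bivector field $\Lambda$ and a smooth vector field $E$ with $[\Lambda,\Lambda]_S=2E\wedge\Lambda$ and $\mathscr L_E\Lambda=0$, i.e. in coordinates $\Lambda^{pi}\partial_p\Lambda^{jk}+\mathrm{cycl}(ijk)=E^i\Lambda^{jk}+\mathrm{cycl}(ijk)$ and $E^k\partial_k\Lambda^{ij}-\Lambda^{kj}\partial_kE^i-\Lambda^{ik}\partial_kE^j=0$. Write $\Lambda(\alpha,\beta)=\Lambda^{ij}\alpha_i\beta_j$, $\sharp\alpha=\alpha_i\Lambda^{ij}\partial_j$ and $\{f,g\}_J=\Lambda(df,dg)+f\,(Eg)-g\,(Ef)$. The Kerbrat–Vaisman bracket of sections of the 1-jet bundle $J^1M=T^*M\oplus\mathbb R$ is $$[(\alpha,f),(\beta,g)]=\bigl(\mathscr L_{\sharp\alpha}\beta-\mathscr L_{\sharp\beta}\alpha-d(\Lambda(\alpha,\beta))+f\mathscr L_E\beta-g\mathscr L_E\alpha-\alpha(E)\beta+\beta(E)\alpha,\ \{f,g\}_J-\Lambda(df-\alpha,dg-\beta)\bigr),$$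 and it is extended pointwise in $u$ to paths of sections, $u\in I=[0,1]$. Let the phase space be the set of smooth paths $u\mapsto(X(u),\zeta(u))$, $I\to T^*M$, with canonical Poisson bracket $\{\zeta_i(u),X^j(v)\}=-\delta_i^j\delta(u-v)$, that is, $\{F,G\}=\int_I\bigl(\frac{\delta F}{\delta X^i}\frac{\delta G}{\delta\zeta_i}-\frac{\delta F}{\delta\zeta_i}\frac{\delta G}{\delta X^i}\bigr)du$ for functionals that have functional derivatives. A gauge parameter is a smooth path $u\mapsto(\beta(u),\lambda_t(u))$ of sections of $J^1M$ (so $\beta=\beta(u,X)$ and $\lambda_t=\lambda_t(u,X)$) with $\beta(0)=\beta(1)=0$ that satisfies the second-class constraint $\beta_iE^i=0$ for all $u\in I$ (i.e. $\beta_m=0$ in coordinates in which $E=\mathcal E\,\partial_m$, $\mathcal E\neq0$). For a smooth function $\lambda_u$ on $I$ put $$K_{(\beta,\lambda_t)}(X,\zeta)=\int_I\Bigl[\beta_i(u,X)\bigl(X'^i+\Lambda^{ij}(X)\zeta_j-E^i(X)\lambda_u\bigr)+\lambda_t(u,X)\,E^i(X)\zeta_i\Bigr]du .$$ Then the following hold.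 1. The gauge parameters form a real vector space that is closed under the Kerbrat–Vaisman bracket, and with this bracket they are a Lie algebra (the bracket is bilinear, skew-symmetric and satisfies the Jacobi identity). 2. The map $(\beta,\lambda_t)\mapsto K_{(\beta,\lambda_t)}$ is linear, and for all gauge parameters, at every point of the phase space (not only on the constraint surface), the Poisson bracket exists and $$\{K_{(\beta,\lambda_t)},K_{(\tilde\beta,\tilde\lambda_t)}\}=-K_{[(\beta,\lambda_t),(\tilde\beta,\tilde\lambda_t)]},$$ so the map is a Lie algebra anti-homomorphism. 3. For all smooth functions $f,g$ on $M$, $[(df,f),(dg,g)]=(d\{f,g\}_J,\{f,g\}_J)$. Hence for gauge parameters of the form $(d\lambda_t,\lambda_t)$ and $(d\tilde\lambda_t,\tilde\lambda_t)$, $$\{K_{(d\lambda_t,\lambda_t)},K_{(d\tilde\lambda_t,\tilde\lambda_t)}\}=-K_{(d\{\lambda_t,\tilde\lambda_t\}_J,\ \{\lambda_t,\tilde\lambda_t\}_J)} .$$ -/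

import Mathlib

open Set MeasureTheory
open scoped Manifold ContDiff

noncomputable section

namespace JacobiSigma

section Fields

variable (E : Type*) [NormedAddCommGroup E] [NormedSpace ℝ E]
variable (M : Type*) [TopologicalSpace M] [ChartedSpace E M]

/-- Vector fields on the manifold `M` (no regularity required here). -/
abbrev VField : Type _ := ∀ x : M, TangentSpace 𝓘(ℝ, E) x

/-- One-forms on the manifold `M` (no regularity required here). -/
abbrev OneForm : Type _ := ∀ x : M, TangentSpace 𝓘(ℝ, E) x →L[ℝ] ℝ

/-- Bivector fields `Λ` on `M`, given by the fibrewise contraction maps `♯ : T*M → TM`,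
`♯ α = α_i Λ^{ij} ∂_j`, so that `Λ(α, β) = β(♯ α)`.  Skew-symmetry is required in
`JacobiStructure` below. -/
abbrev SharpField : Type _ :=
  ∀ x : M, (TangentSpace 𝓘(ℝ, E) x →L[ℝ] ℝ) →ₗ[ℝ] TangentSpace 𝓘(ℝ, E) x

/-- Sections `(α, f)` of the 1-jet bundle `J¹M = T*M ⊕ ℝ`. -/
abbrev JetSection : Type _ := OneForm E M × (M → ℝ)

/-- Paths of sections of the 1-jet bundle; only the values for `u ∈ [0, 1]` are relevant. -/
abbrev JetPath : Type _ := ℝ → JetSection E M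

end Fields

section Charts

variable {E : Type*} [NormedAddCommGroup E] [NormedSpace ℝ E]
variable {M : Type*} [TopologicalSpace M] [ChartedSpace E M]

/-- The inverse of the preferred chart at `x₀`. -/
def chartInv (x₀ : M) : E → M := (extChartAt 𝓘(ℝ, E) x₀).symm

/-- The domain in `E` of the inverse of the preferred chart at `x₀`. -/
def chartTarget (x₀ : M) : Set E := (extChartAt 𝓘(ℝ, E) x₀).target

/-- Components `α_i` of a one-form in the preferred chart at `x₀`, as a map on the chart domain
in `E`. -/
def oneFormRep (x₀ : M) (α : OneForm E M) (y : E) : E →L[ℝ] ℝ :=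
  (α (chartInv x₀ y)).comp (mfderiv 𝓘(ℝ, E) 𝓘(ℝ, E) (chartInv (E := E) x₀) y)

/-- Components `V^i` of a vector field in the preferred chart at `x₀`. -/
def vectorRep (x₀ : M) (V : VField E M) (y : E) : E :=
  mfderiv 𝓘(ℝ, E) 𝓘(ℝ, E) (extChartAt 𝓘(ℝ, E) x₀) (chartInv x₀ y) (V (chartInv x₀ y))

/-- The components `a_i Λ^{ij}` of `♯ a` in the preferred chart at `x₀`, where `a` is the covector
with constant components `a_i`.  So `b (sharpRep x₀ S a y)` is `a_i b_j Λ^{ij}(y)`. -/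
def sharpRep (x₀ : M) (S : SharpField E M) (a : E →L[ℝ] ℝ) (y : E) : E :=
  mfderiv 𝓘(ℝ, E) 𝓘(ℝ, E) (extChartAt 𝓘(ℝ, E) x₀) (chartInv x₀ y)
    (S (chartInv x₀ y)
      (a.comp (mfderiv 𝓘(ℝ, E) 𝓘(ℝ, E) (extChartAt 𝓘(ℝ, E) x₀) (chartInv x₀ y))))

/-- The differential of a function. -/
def dFun (f : M → ℝ) : OneForm E M := fun x => mfderiv 𝓘(ℝ, E) 𝓘(ℝ, ℝ) f x

/-- The Lie derivative of a one-form, `(L_V α)_i = V^k ∂_k α_i + α_k ∂_i V^k`, computed at `x` in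
the preferred chart at `x` (whose differential at `x` is the identity of `T_x M = E`). -/
def lieDeriv (V : VField E M) (α : OneForm E M) : OneForm E M := fun x =>
  let y : E := extChartAt 𝓘(ℝ, E) x x
  (fderiv ℝ (oneFormRep x α) y (vectorRep x V y)
    + (oneFormRep x α y).comp (fderiv ℝ (vectorRep x V) y) : E →L[ℝ] ℝ)

end Charts

section Jacobi

/-- A Jacobi structure `(Λ, E)` on the manifold `M`: a smooth bivector field `Λ` (given by `♯`) and
a smooth vector field (the Reeb vector field) with `[Λ, Λ]_S = 2 E ∧ Λ` and `L_E Λ = 0`.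

In the preferred charts (which cover `M`) the two conditions are
`Λ^{pi} ∂_p Λ^{jk} + cycl(ijk) = E^i Λ^{jk} + cycl(ijk)` and
`E^k ∂_k Λ^{ij} - Λ^{kj} ∂_k E^i - Λ^{ik} ∂_k E^j = 0`;
below they are contracted with constant covectors `a_i`, `b_j`, `c_k`, and `Λ^{pi} a_i` is
`-(♯ a)^p`. -/
structure JacobiStructure (E : Type*) [NormedAddCommGroup E] [NormedSpace ℝ E]
    (M : Type*) [TopologicalSpace M] [ChartedSpace E M] where
  sharp : SharpField E M
  reeb : VField E M
  sharp_skew : ∀ (x : M) (α β : TangentSpace 𝓘(ℝ, E) x →L[ℝ] ℝ),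
    β (sharp x α) = - α (sharp x β)
  sharp_smooth : ∀ (x₀ : M) (a : E →L[ℝ] ℝ), ContDiffOn ℝ ∞ (sharpRep x₀ sharp a) (chartTarget x₀)
  reeb_smooth : ∀ x₀ : M, ContDiffOn ℝ ∞ (vectorRep x₀ reeb) (chartTarget x₀)
  schouten_self : ∀ (x₀ : M), ∀ y ∈ chartTarget (E := E) x₀, ∀ a b c : E →L[ℝ] ℝ,
    - (fderiv ℝ (fun z => c (sharpRep x₀ sharp b z)) y (sharpRep x₀ sharp a y)
      + fderiv ℝ (fun z => a (sharpRep x₀ sharp c z)) y (sharpRep x₀ sharp b y)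
      + fderiv ℝ (fun z => b (sharpRep x₀ sharp a z)) y (sharpRep x₀ sharp c y))
    = a (vectorRep x₀ reeb y) * c (sharpRep x₀ sharp b y)
      + b (vectorRep x₀ reeb y) * a (sharpRep x₀ sharp c y)
      + c (vectorRep x₀ reeb y) * b (sharpRep x₀ sharp a y)
  lie_reeb : ∀ (x₀ : M), ∀ y ∈ chartTarget (E := E) x₀, ∀ a b : E →L[ℝ] ℝ,
    fderiv ℝ (fun z => b (sharpRep x₀ sharp a z)) y (vectorRep x₀ reeb y)
      - fderiv ℝ (fun z => a (vectorRep x₀ reeb z)) y (- sharpRep x₀ sharp b y)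
      - fderiv ℝ (fun z => b (vectorRep x₀ reeb z)) y (sharpRep x₀ sharp a y) = 0

variable {E : Type*} [NormedAddCommGroup E] [NormedSpace ℝ E]
variable {M : Type*} [TopologicalSpace M] [ChartedSpace E M]

/-- The function `Λ(α, β) = α_i β_j Λ^{ij}`. -/
def JacobiStructure.lam (J : JacobiStructure E M) (α β : OneForm E M) : M → ℝ :=
  fun x => β x (J.sharp x (α x))

/-- The vector field `♯ α`. -/
def JacobiStructure.sharpField (J : JacobiStructure E M) (α : OneForm E M) : VField E M :=
  fun x => J.sharp x (α x)

/-- The function `α(E)`, with `E` the Reeb vector field. -/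
def JacobiStructure.onReeb (J : JacobiStructure E M) (α : OneForm E M) : M → ℝ :=
  fun x => α x (J.reeb x)

/-- The Jacobi bracket `{f, g}_J = Λ(df, dg) + f (E g) - g (E f)`. -/
def jacobiBracket (J : JacobiStructure E M) (f g : M → ℝ) : M → ℝ := fun x =>
  J.lam (dFun f) (dFun g) x + f x * J.onReeb (dFun g) x - g x * J.onReeb (dFun f) x

/-- The Kerbrat-Vaisman bracket of sections `(α, f)`, `(β, g)` of the 1-jet bundle:
`(L_{♯α} β - L_{♯β} α - d(Λ(α,β)) + f L_E β - g L_E α - α(E) β + β(E) α,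
{f,g}_J - Λ(df - α, dg - β))`. -/
def kvBracket (J : JacobiStructure E M) (p q : JetSection E M) : JetSection E M :=
  (fun x =>
      lieDeriv (J.sharpField p.1) q.1 x - lieDeriv (J.sharpField q.1) p.1 x
        - dFun (J.lam p.1 q.1) x
        + p.2 x • lieDeriv J.reeb q.1 x - q.2 x • lieDeriv J.reeb p.1 x
        - J.onReeb p.1 x • q.1 x + J.onReeb q.1 x • p.1 x,
    fun x => jacobiBracket J p.2 q.2 x - J.lam (dFun p.2 - p.1) (dFun q.2 - q.1) x)

/-- The bracket extended pointwise to paths of sections. -/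
def pathBracket (J : JacobiStructure E M) (p q : JetPath E M) : JetPath E M :=
  fun u => kvBracket J (p u) (q u)

/-- The section `j¹f = (df, f)` of the 1-jet bundle. -/
def jet (f : M → ℝ) : JetSection E M := (dFun f, f)

/-- A path `u ↦ (β(u, ·), λ(u, ·))`, `u ∈ [0, 1]`, of sections of the 1-jet bundle is smooth if
it is jointly smooth in `u` and the point of `M`, in charts covering `M`. -/
def IsSmoothJetPath (p : JetPath E M) : Prop :=
  ∀ x₀ : M,
    ContDiffOn ℝ ∞ (fun z : ℝ × E => oneFormRep x₀ (p z.1).1 z.2)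
      (Icc (0 : ℝ) 1 ×ˢ chartTarget x₀) ∧
    ContDiffOn ℝ ∞ (fun z : ℝ × E => (p z.1).2 (chartInv x₀ z.2))
      (Icc (0 : ℝ) 1 ×ˢ chartTarget x₀)

/-- Gauge parameters `(β, λ_t)`: smooth paths of sections of the 1-jet bundle with the boundary
condition `β(0) = β(1) = 0` and subject to the second class constraint `β_i E^i = 0`
(that is, `β_m = 0` in coordinates with `E = ℰ ∂_m`, `ℰ ≠ 0`). -/
structure IsGaugeParameter (J : JacobiStructure E M) (p : JetPath E M) : Prop where
  smooth : IsSmoothJetPath p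
  reeb : ∀ u ∈ Icc (0 : ℝ) 1, ∀ x : M, (p u).1 x (J.reeb x) = 0
  left : (p 0).1 = 0
  right : (p 1).1 = 0

end Jacobi

section PhaseSpace

variable {E : Type*} [NormedAddCommGroup E] [NormedSpace ℝ E]
variable {M : Type*} [TopologicalSpace M] [ChartedSpace E M]

/-- Smoothness on the set `S` of a map `p ↦ (X p, ζ p)` from a normed space to `T*M`: the base map
is smooth, and so are the components of `ζ` in charts covering `M`. -/
def SmoothCotangentOn {P : Type*} [NormedAddCommGroup P] [NormedSpace ℝ P] (X : P → M)
    (ζ : ∀ p, TangentSpace 𝓘(ℝ, E) (X p) →L[ℝ] ℝ) (S : Set P) : Prop :=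
  ContMDiffOn 𝓘(ℝ, P) 𝓘(ℝ, E) ∞ X S ∧
  ∀ x₀ : M, ContDiffOn ℝ ∞
    (fun p => ((ζ p).comp
      (mfderiv 𝓘(ℝ, E) 𝓘(ℝ, E) (chartInv (E := E) x₀) (extChartAt 𝓘(ℝ, E) x₀ (X p))) :
        E →L[ℝ] ℝ))
    (S ∩ X ⁻¹' (chartAt E x₀).source)

/-- A point `(X, ζ)` of the phase space `T*PM` of smooth paths `[0, 1] → T*M`; the momentum
conjugate to `X` is `π = -ζ`.  Only the values for `u ∈ [0, 1]` are relevant. -/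
structure PhasePoint (E : Type*) [NormedAddCommGroup E] [NormedSpace ℝ E]
    (M : Type*) [TopologicalSpace M] [ChartedSpace E M] where
  X : ℝ → M
  ζ : ∀ u : ℝ, TangentSpace 𝓘(ℝ, E) (X u) →L[ℝ] ℝ
  smooth : SmoothCotangentOn X ζ (Icc (0 : ℝ) 1)

/-- A smooth one-parameter family of points of the phase space. -/
def IsSmoothVariation (Γ : ℝ → PhasePoint E M) : Prop :=
  SmoothCotangentOn (fun z : ℝ × ℝ => (Γ z.1).X z.2) (fun z => (Γ z.1).ζ z.2)
    (univ ×ˢ Icc (0 : ℝ) 1)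

/-- `δX(u) = ∂_s X_s(u)` at `s = 0`. -/
def deltaX (Γ : ℝ → PhasePoint E M) (u : ℝ) : E :=
  mfderiv 𝓘(ℝ, ℝ) 𝓘(ℝ, E) (fun s => (Γ s).X u) 0 (1 : ℝ)

/-- `δζ(u)`: the derivative at `s = 0` of the components of `ζ_s(u)` in the preferred chart
at `X_0(u)`. -/
def deltaZeta (Γ : ℝ → PhasePoint E M) (u : ℝ) : E →L[ℝ] ℝ :=
  deriv (fun s => (((Γ s).ζ u).comp
    (mfderiv 𝓘(ℝ, E) 𝓘(ℝ, E) (chartInv (E := E) ((Γ 0).X u))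
      (extChartAt 𝓘(ℝ, E) ((Γ 0).X u) ((Γ s).X u))) : E →L[ℝ] ℝ)) 0

/-- `A = δF/δζ` and `B = δF/δX` are the functional derivatives of `F` at the phase space point `Z`:
`d/ds F(Z_s) = ∫ (A^i δζ_i + B_i δX^i) du` at `s = 0` for all smooth variations `Z_s` of `Z`.
At each `u` the components are those of the preferred chart at `X(u)`.  Functional derivatives are
determined up to null sets. -/
def HasFunctionalDerivAt (F : PhasePoint E M → ℝ) (Z : PhasePoint E M)
    (A : ℝ → E) (B : ℝ → E →L[ℝ] ℝ) : Prop :=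
  ∀ Γ : ℝ → PhasePoint E M, IsSmoothVariation Γ → Γ 0 = Z →
    IntervalIntegrable (fun u => deltaZeta Γ u (A u) + B u (deltaX Γ u)) volume 0 1 ∧
    HasDerivAt (fun s => F (Γ s))
      (∫ u in (0 : ℝ)..1, (deltaZeta Γ u (A u) + B u (deltaX Γ u))) 0

/-- `{F, G}(Z) = c` for the canonical Poisson bracket with
`{ζ_i(u), X^j(v)} = -δ_i^j δ(u - v)`, that is
`{F, G} = ∫ (δF/δX^i δG/δζ_i - δF/δζ_i δG/δX^i) du`
(an expression which does not depend on the chart used at `u`).  The functionals are required to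
have functional derivatives, and the integral is required to exist. -/
def HasPoissonBracketAt (F G : PhasePoint E M → ℝ) (Z : PhasePoint E M) (c : ℝ) : Prop :=
  ∃ (A A' : ℝ → E) (B B' : ℝ → E →L[ℝ] ℝ),
    HasFunctionalDerivAt F Z A B ∧ HasFunctionalDerivAt G Z A' B' ∧
    IntervalIntegrable (fun u => B u (A' u) - B' u (A u)) volume 0 1 ∧
    c = ∫ u in (0 : ℝ)..1, (B u (A' u) - B' u (A u))

/-- The constraint `𝒢_β = X'^i + Λ^{ij} ζ_j - E^i λ_u` (a vector at `X(u)`; note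
`Λ^{ij} ζ_j = -(♯ ζ)^i`). -/
def constraintBeta (J : JacobiStructure E M) (lamU : ℝ → ℝ) (Z : PhasePoint E M) (u : ℝ) :
    TangentSpace 𝓘(ℝ, E) (Z.X u) :=
  mfderivWithin 𝓘(ℝ, ℝ) 𝓘(ℝ, E) Z.X (Icc (0 : ℝ) 1) u (1 : ℝ)
    - J.sharp (Z.X u) (Z.ζ u) - lamU u • J.reeb (Z.X u)

/-- The constraint `𝒢_{λ_t} = E^i ζ_i`. -/
def constraintLambda (J : JacobiStructure E M) (Z : PhasePoint E M) (u : ℝ) : ℝ :=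
  Z.ζ u (J.reeb (Z.X u))

/-- The generating functional `K_{(β, λ_t)} = ∫_0^1 (β_i 𝒢_{β_i} + λ_t 𝒢_{λ_t}) du`, with
`β = β(u, X(u))` and `λ_t = λ_t(u, X(u))`. -/
def generator (J : JacobiStructure E M) (lamU : ℝ → ℝ) (p : JetPath E M)
    (Z : PhasePoint E M) : ℝ :=
  ∫ u in (0 : ℝ)..1,
    ((p u).1 (Z.X u) (constraintBeta J lamU Z u) + (p u).2 (Z.X u) * constraintLambda J Z u)

end PhaseSpace

end JacobiSigma

end

/-!
On sections `(β, λ)` of the 1-jet bundle with `β(E) = 0` the Kerbrat–Vaisman bracket is a Courant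
bracket. Put `V = ♯β + λ E` (the anchor). Since `β(E) = 0`, the pairing `β̃(V) = Λ(β, β̃)` is skew,
and for two such sections with anchors `V`, `W`
`[(β, λ), (β̃, λ̃)] = (L_V β̃ - L_W β - d(β̃(V)), V(λ̃) - W(λ) - β̃(V))`
(`IsGaugeSection.rep_bracket_fst`, `IsGaugeSection.rep_bracket_snd`). The two conditions on a
Jacobi structure together make the anchor map this bracket to the Lie bracket of vector fields
(`IsLocalJacobi.lieBracket_locAnchor`), and `L_E Λ = 0` makes the bracket preserve `β(E) = 0`
(`IsLocalJacobi.courantForm_reeb`). Given this, the Jacobi identity is Cartan calculus: the terms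
without `d` cancel because `[L_V, L_W] = L_[V, W]`, and the remainder is, up to sign, (the
differential of) the cyclic sum of `V₁(α₃(V₂)) - α₁([V₂, V₃])`, which the skewness of the pairing
forces to equal minus twice itself (`IsCourantTriple.cyclic_sum_eq_zero`).

The constraint `β(E) = 0` also removes `λ_u` from the generating functional, which becomes
`K = ∫ (β(X') + ζ(V)) du`. Its functional derivatives are `δK/δζ = V` and
`δK/δX^i = ∂_i β_k X'^k - d/du(β_i) + ζ_k ∂_i V^k`; the boundary term `β(δX)` of the first variation
is zero because `β` vanishes at the ends of the interval (`hasFunctionalDerivAt_generator`).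
Inserting them, the Poisson bracket density of two generators is minus the density of the generator
of the bracket, minus the total derivative of `β(W)`: the homomorphism property of the anchor
accounts for the terms with `ζ`, the formula for the bracket for those with `X'`, and the explicit
`u`-derivatives combine by skewness of `Λ` (`poisson_density`). The total derivative integrates to
zero.

All identities between densities are verified at one `u` in the open interval `(0, 1)`, in the
preferred chart at `X(u)`. Smoothness up to the end points, which differentiation under the integral
sign and the fundamental theorem of calculus require, is obtained chart by chart for the globally
defined densities. That the Lie derivative of a one-form, defined through the preferred chart at
each point, is given by the coordinate formula in every chart is `oneFormRep_lieDeriv`.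
-/

noncomputable section

namespace JacobiSigma

/-! ### Vector fields and one-forms on open subsets of a vector space -/

section LocalCalculus

open VectorField

variable {E : Type*} [NormedAddCommGroup E] [NormedSpace ℝ E]

/-- The Lie derivative `V^k ∂_k a_i + a_k ∂_i V^k` of a one-form on an open set of a vector
space. -/
def locLie (V : E → E) (a : E → E →L[ℝ] ℝ) (z : E) : E →L[ℝ] ℝ :=
  fderiv ℝ a z (V z) + (a z).comp (fderiv ℝ V z)

lemma fderiv_congr_of_isOpen {F : Type*} [NormedAddCommGroup F] [NormedSpace ℝ F]
    {U : Set E} (hU : IsOpen U) {f g : E → F} (h : ∀ z ∈ U, f z = g z) {z : E} (hz : z ∈ U) :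
    fderiv ℝ f z = fderiv ℝ g z :=
  Filter.EventuallyEq.fderiv_eq (Filter.eventuallyEq_of_mem (hU.mem_nhds hz) h)

lemma locLie_congr {U : Set E} (hU : IsOpen U) {V V' : E → E} {a a' : E → E →L[ℝ] ℝ}
    (h : ∀ z ∈ U, V z = V' z) (h' : ∀ z ∈ U, a z = a' z) {z : E} (hz : z ∈ U) :
    locLie V a z = locLie V' a' z := by
  simp only [locLie, fderiv_congr_of_isOpen hU h hz, fderiv_congr_of_isOpen hU h' hz,
    h z hz, h' z hz]

lemma fderiv_pairing {a : E → E →L[ℝ] ℝ} {W : E → E} {z : E} (ha : DifferentiableAt ℝ a z)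
    (hW : DifferentiableAt ℝ W z) (v : E) :
    fderiv ℝ (fun z => a z (W z)) z v = fderiv ℝ a z v (W z) + a z (fderiv ℝ W z v) := by
  rw [fderiv_clm_apply ha hW]
  simp [add_comm]

lemma locLie_apply {V W : E → E} {a : E → E →L[ℝ] ℝ} {z : E} (ha : DifferentiableAt ℝ a z)
    (hW : DifferentiableAt ℝ W z) :
    locLie V a z (W z)
      = fderiv ℝ (fun z => a z (W z)) z (V z) - a z (lieBracket ℝ V W z) := by
  rw [fderiv_pairing ha hW]
  simp [locLie, lieBracket_eq]
  ring

lemma contDiffOn_locLie {U : Set E} (hU : IsOpen U) {V : E → E} {a : E → E →L[ℝ] ℝ}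
    (hV : ContDiffOn ℝ ∞ V U) (ha : ContDiffOn ℝ ∞ a U) :
    ContDiffOn ℝ ∞ (locLie V a) U :=
  ((ha.fderiv_of_isOpen hU le_rfl).clm_apply hV).add
    (ha.clm_comp (hV.fderiv_of_isOpen hU le_rfl))

lemma differentiableAt_of_contDiffOn {F : Type*} [NormedAddCommGroup F] [NormedSpace ℝ F]
    {U : Set E} (hU : IsOpen U) {f : E → F} (hf : ContDiffOn ℝ ∞ f U) {z : E} (hz : z ∈ U) :
    DifferentiableAt ℝ f z :=
  (hf.contDiffAt (hU.mem_nhds hz)).differentiableAt (by simp)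

lemma second_fderiv_symm {F : Type*} [NormedAddCommGroup F] [NormedSpace ℝ F]
    {f : E → F} {z : E} (hf : ContDiffAt ℝ ∞ f z) (v w : E) :
    fderiv ℝ (fderiv ℝ f) z v w = fderiv ℝ (fderiv ℝ f) z w v :=
  (hf.isSymmSndFDerivAt (by simpa using! (mod_cast le_top : ((2 : ℕ∞) : WithTop ℕ∞) ≤ ∞))) v w

lemma differentiableAt_fderiv {F : Type*} [NormedAddCommGroup F] [NormedSpace ℝ F]
    {f : E → F} {z : E} (hf : ContDiffAt ℝ ∞ f z) : DifferentiableAt ℝ (fderiv ℝ f) z :=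
  (hf.fderiv_right (m := ∞) le_rfl).differentiableAt (by simp)

lemma locLie_fderiv {V : E → E} {f : E → ℝ} {z : E} (hf : ContDiffAt ℝ ∞ f z)
    (hV : DifferentiableAt ℝ V z) :
    locLie V (fderiv ℝ f) z = fderiv ℝ (fun z => fderiv ℝ f z (V z)) z := by
  ext w
  rw [fderiv_pairing (differentiableAt_fderiv hf) hV]
  simp [locLie, second_fderiv_symm hf w (V z)]

/-- `L_V L_W - L_W L_V = L_{[V, W]}` on one-forms. -/
lemma locLie_commutator {V W : E → E} {a : E → E →L[ℝ] ℝ} {z : E} (ha : ContDiffAt ℝ ∞ a z)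
    (hV : ContDiffAt ℝ ∞ V z) (hW : ContDiffAt ℝ ∞ W z) :
    locLie V (locLie W a) z - locLie W (locLie V a) z = locLie (lieBracket ℝ V W) a z := by
  -- Both sides are expanded to second derivatives of `a`, `V`, `W`; these cancel or match by the
  -- symmetry of second derivatives.
  have key : ∀ {V W : E → E}, ContDiffAt ℝ ∞ V z → ContDiffAt ℝ ∞ W z → ∀ w,
      locLie V (locLie W a) z w
        = fderiv ℝ (fderiv ℝ a) z (V z) (W z) w + fderiv ℝ a z (fderiv ℝ W z (V z)) w
          + fderiv ℝ a z (V z) (fderiv ℝ W z w) + a z (fderiv ℝ (fderiv ℝ W) z (V z) w)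
          + (fderiv ℝ a z (W z) (fderiv ℝ V z w) + a z (fderiv ℝ W z (fderiv ℝ V z w))) := by
    intro V W hV hW w
    have h1 : HasFDerivAt (locLie W a) _ z :=
      ((differentiableAt_fderiv ha).hasFDerivAt.clm_apply
        (hW.differentiableAt (by simp)).hasFDerivAt).add
      ((ha.differentiableAt (by simp)).hasFDerivAt.clm_comp
        (differentiableAt_fderiv hW).hasFDerivAt)
    have h2 : fderiv ℝ (locLie W a) z = _ := h1.fderiv
    simp only [locLie] at h2 ⊢
    rw [h2]
    simp
    ring
  have hb : ∀ w, fderiv ℝ (lieBracket ℝ V W) z w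
      = fderiv ℝ (fderiv ℝ W) z w (V z) + fderiv ℝ W z (fderiv ℝ V z w)
        - (fderiv ℝ (fderiv ℝ V) z w (W z) + fderiv ℝ V z (fderiv ℝ W z w)) := by
    intro w
    have h1 : HasFDerivAt (lieBracket ℝ V W) _ z :=
      ((differentiableAt_fderiv hW).hasFDerivAt.clm_apply
        (hV.differentiableAt (by simp)).hasFDerivAt).sub
      ((differentiableAt_fderiv hV).hasFDerivAt.clm_apply
        (hW.differentiableAt (by simp)).hasFDerivAt)
    rw [h1.fderiv]
    simp
    abel
  ext w
  rw [sub_apply, key hV hW w, key hW hV w]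
  simp only [locLie, add_apply, ContinuousLinearMap.comp_apply, hb w, map_sub, map_add,
    second_fderiv_symm ha (W z) (V z), second_fderiv_symm hV (W z) w,
    second_fderiv_symm hW (V z) w]
  simp only [lieBracket_eq, map_sub, sub_apply]
  ring

lemma locLie_add_smul {V R : E → E} {f : E → ℝ} {a : E → E →L[ℝ] ℝ} {z : E}
    (hV : DifferentiableAt ℝ V z) (hR : DifferentiableAt ℝ R z) (hf : DifferentiableAt ℝ f z) :
    locLie (fun z => V z + f z • R z) a z
      = locLie V a z + f z • locLie R a z + a z (R z) • fderiv ℝ f z := by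
  ext w
  have h : fderiv ℝ (fun z => V z + f z • R z) z w
      = fderiv ℝ V z w + (f z • fderiv ℝ R z w + fderiv ℝ f z w • R z) := by
    rw [fderiv_fun_add hV (hf.fun_smul hR), fderiv_fun_smul hf hR]
    simp
  simp only [locLie, add_apply, ContinuousLinearMap.comp_apply, h, map_add, map_smul, smul_apply,
    smul_eq_mul]
  ring

/-- The Lie derivative of one-forms is natural under a change of coordinates `τ`. -/
lemma locLie_natural {τ : E → E} {V V' : E → E} {a a' : E → E →L[ℝ] ℝ} {z : E} {U : Set E}
    (hU : IsOpen U) (hz : z ∈ U) (hτ : ContDiffAt ℝ ∞ τ z)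
    (hV : DifferentiableAt ℝ V z) (hV' : DifferentiableAt ℝ V' (τ z))
    (ha' : DifferentiableAt ℝ a' (τ z))
    (hVV : ∀ x ∈ U, fderiv ℝ τ x (V x) = V' (τ x))
    (haa : ∀ x ∈ U, a x = (a' (τ x)).comp (fderiv ℝ τ x)) :
    locLie V a z = (locLie V' a' (τ z)).comp (fderiv ℝ τ z) := by
  have hd := (hτ.differentiableAt (by simp)).hasFDerivAt
  have hdd := (differentiableAt_fderiv hτ).hasFDerivAt
  have h1 : fderiv ℝ a z = _ := (fderiv_congr_of_isOpen hU haa hz).trans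
    ((ha'.hasFDerivAt.comp z hd).clm_comp hdd).fderiv
  have h2 := fderiv_congr_of_isOpen hU hVV hz
  have h0 : HasFDerivAt (fun x => V' (τ x)) ((fderiv ℝ V' (τ z)).comp (fderiv ℝ τ z)) z :=
    hV'.hasFDerivAt.comp z hd
  rw [(hdd.clm_apply hV.hasFDerivAt).fderiv, h0.fderiv] at h2
  ext w
  have h3 : fderiv ℝ τ z (fderiv ℝ V z w) + fderiv ℝ (fderiv ℝ τ) z w (V z)
      = fderiv ℝ V' (τ z) (fderiv ℝ τ z w) := by
    simpa using DFunLike.congr_fun h2 w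
  have h4 : fderiv ℝ V' (τ z) (fderiv ℝ τ z w)
      = fderiv ℝ τ z (fderiv ℝ V z w) + fderiv ℝ (fderiv ℝ τ) z w (V z) := h3.symm
  simp only [locLie, add_apply, ContinuousLinearMap.comp_apply, h4, h1, map_add,
    second_fderiv_symm hτ w (V z), haa z hz, ← hVV z hz]
  simp
  ring

end LocalCalculus

/-! ### Jacobi structures in coordinates -/

section LocalJacobi

open VectorField

universe u

variable {E : Type u} [NormedAddCommGroup E] [NormedSpace ℝ E]

/-- A Jacobi structure on an open subset `U` of a vector space: `L z` is the contraction map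
`♯` at `z` and `R` is the Reeb vector field. -/
structure IsLocalJacobi (U : Set E) (L : E → (E →L[ℝ] ℝ) →L[ℝ] E) (R : E → E) : Prop where
  isOpen : IsOpen U
  skew : ∀ z ∈ U, ∀ a b : E →L[ℝ] ℝ, b (L z a) = - a (L z b)
  smooth : ContDiffOn ℝ ∞ L U
  smooth_reeb : ContDiffOn ℝ ∞ R U
  schouten : ∀ z ∈ U, ∀ a b c : E →L[ℝ] ℝ,
    - (c (fderiv ℝ L z (L z a) b) + a (fderiv ℝ L z (L z b) c) + b (fderiv ℝ L z (L z c) a))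
      = a (R z) * c (L z b) + b (R z) * a (L z c) + c (R z) * b (L z a)
  lie_reeb : ∀ z ∈ U, ∀ a b : E →L[ℝ] ℝ,
    b (fderiv ℝ L z (R z) a) + a (fderiv ℝ R z (L z b)) - b (fderiv ℝ R z (L z a)) = 0

namespace IsLocalJacobi

variable {U : Set E} {L : E → (E →L[ℝ] ℝ) →L[ℝ] E} {R : E → E}

lemma fderiv_skew (h : IsLocalJacobi U L R) {z : E} (hz : z ∈ U) (a b : E →L[ℝ] ℝ) (v : E) :
    b (fderiv ℝ L z v a) = - a (fderiv ℝ L z v b) := by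
  have hL := differentiableAt_of_contDiffOn h.isOpen h.smooth hz
  have key : ∀ a b : E →L[ℝ] ℝ,
      fderiv ℝ (fun z => b (L z a)) z = b.comp ((fderiv ℝ L z).flip a) := by
    intro a b
    have := (b.hasFDerivAt.comp z (hL.hasFDerivAt.clm_apply (hasFDerivAt_const a z))).fderiv
    simpa [Function.comp_def] using this
  have h1 := fderiv_congr_of_isOpen h.isOpen (fun z hz => h.skew z hz a b) hz
  rw [key, fderiv_fun_neg, key] at h1
  simpa using DFunLike.congr_fun h1 v

lemma fderiv_sharp (h : IsLocalJacobi U L R) {z : E} (hz : z ∈ U) {a : E → E →L[ℝ] ℝ}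
    (ha : ContDiffOn ℝ ∞ a U) (v : E) :
    fderiv ℝ (fun z => L z (a z)) z v = fderiv ℝ L z v (a z) + L z (fderiv ℝ a z v) := by
  rw [fderiv_clm_apply (differentiableAt_of_contDiffOn h.isOpen h.smooth hz)
    (differentiableAt_of_contDiffOn h.isOpen ha hz)]
  simp [add_comm]

lemma contDiffOn_sharp (h : IsLocalJacobi U L R) {a : E → E →L[ℝ] ℝ}
    (ha : ContDiffOn ℝ ∞ a U) : ContDiffOn ℝ ∞ (fun z => L z (a z)) U :=
  h.smooth.clm_apply ha

/-- `[E, ♯a] = ♯ L_E a`, a form of `L_E Λ = 0`. -/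
lemma lieBracket_reeb_sharp (h : IsLocalJacobi U L R) {z : E} (hz : z ∈ U) {a : E → E →L[ℝ] ℝ}
    (ha : ContDiffOn ℝ ∞ a U) :
    lieBracket ℝ R (fun z => L z (a z)) z = L z (locLie R a z) := by
  refine (SeparatingDual.eq_iff_forall_dual_eq (R := ℝ)).2 fun c => ?_
  rw [lieBracket_eq]
  simp only [h.fderiv_sharp hz ha, locLie, map_add, map_sub]
  rw [h.skew z hz ((a z).comp _) c]
  have := h.lie_reeb z hz (a z) c
  simp only [ContinuousLinearMap.comp_apply]
  linarith

/-- `[♯a, ♯b] = ♯ (L_{♯a} b - L_{♯b} a - d(Λ(a, b))) - Λ(a, b) E` on one-forms that annihilate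
the Reeb field; this is the content of `[Λ, Λ] = 2 E ∧ Λ` for such forms. -/
lemma lieBracket_sharp_sharp (h : IsLocalJacobi U L R) {z : E} (hz : z ∈ U)
    {a b : E → E →L[ℝ] ℝ} (ha : ContDiffOn ℝ ∞ a U) (hb : ContDiffOn ℝ ∞ b U)
    (haR : a z (R z) = 0) (hbR : b z (R z) = 0) :
    lieBracket ℝ (fun z => L z (a z)) (fun z => L z (b z)) z
      = L z (locLie (fun z => L z (a z)) b z - locLie (fun z => L z (b z)) a z
          - fderiv ℝ (fun z => b z (L z (a z))) z) - b z (L z (a z)) • R z := by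
  refine (SeparatingDual.eq_iff_forall_dual_eq (R := ℝ)).2 fun c => ?_
  have hLa := differentiableAt_of_contDiffOn h.isOpen (h.contDiffOn_sharp ha) hz
  have hLb := differentiableAt_of_contDiffOn h.isOpen (h.contDiffOn_sharp hb) hz
  have hb' := differentiableAt_of_contDiffOn h.isOpen hb hz
  rw [map_sub, h.skew z hz _ c, lieBracket_eq]
  simp only [h.fderiv_sharp hz ha, h.fderiv_sharp hz hb, locLie, map_add, map_sub,
    sub_apply, add_apply, ContinuousLinearMap.comp_apply, fderiv_pairing hb' hLa, map_smul,
    smul_eq_mul]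
  rw [h.skew z hz _ (a z), h.skew z hz (fderiv ℝ b z (L z (a z))) c,
    h.skew z hz (fderiv ℝ a z (L z (b z))) c]
  have h1 := h.schouten z hz (a z) (b z) c
  have h2 := h.fderiv_skew hz c (a z) (L z (b z))
  have h3 := h.fderiv_skew hz (b z) (a z) (L z c)
  rw [haR, hbR] at h1
  linarith

/-- The anchor `♯a + f E` of a section `(a, f)` of the 1-jet bundle. -/
def locAnchor (L : E → (E →L[ℝ] ℝ) →L[ℝ] E) (R : E → E) (a : E → E →L[ℝ] ℝ) (f : E → ℝ) (z : E) :
    E := L z (a z) + f z • R z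

lemma contDiffOn_locAnchor (h : IsLocalJacobi U L R) {a : E → E →L[ℝ] ℝ} {f : E → ℝ}
    (ha : ContDiffOn ℝ ∞ a U) (hf : ContDiffOn ℝ ∞ f U) :
    ContDiffOn ℝ ∞ (locAnchor L R a f) U :=
  (h.contDiffOn_sharp ha).add (hf.smul h.smooth_reeb)

lemma fderiv_locAnchor (h : IsLocalJacobi U L R) {z : E} (hz : z ∈ U) {a : E → E →L[ℝ] ℝ}
    {f : E → ℝ} (ha : ContDiffOn ℝ ∞ a U) (hf : ContDiffOn ℝ ∞ f U) (w : E) :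
    fderiv ℝ (locAnchor L R a f) z w = fderiv ℝ (fun z => L z (a z)) z w
      + (f z • fderiv ℝ R z w + fderiv ℝ f z w • R z) := by
  have hLa := differentiableAt_of_contDiffOn h.isOpen (h.contDiffOn_sharp ha) hz
  have hf' := differentiableAt_of_contDiffOn h.isOpen hf hz
  have hR' := differentiableAt_of_contDiffOn h.isOpen h.smooth_reeb hz
  have e : locAnchor L R a f = fun z => L z (a z) + f z • R z := rfl
  rw [e, fderiv_fun_add hLa (hf'.fun_smul hR'), fderiv_fun_smul hf' hR']
  simp

end IsLocalJacobi

/-- `L_V b - L_W a - d(b(V))`, the one-form component of the Courant bracket of `(V, a)` and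
`(W, b)`, as long as `b(V) = -a(W)`. -/
def courantForm (V W : E → E) (a b : E → E →L[ℝ] ℝ) (z : E) : E →L[ℝ] ℝ :=
  locLie V b z - locLie W a z - fderiv ℝ (fun z => b z (V z)) z

/-- `V(g) - W(f) - b(V)`, the function component of the bracket. -/
def courantFun (V W : E → E) (b : E → E →L[ℝ] ℝ) (f g : E → ℝ) (z : E) : ℝ :=
  fderiv ℝ g z (V z) - fderiv ℝ f z (W z) - b z (V z)

lemma courantForm_congr {U : Set E} (hU : IsOpen U) {V V' W W' : E → E}
    {a a' b b' : E → E →L[ℝ] ℝ} (hV : ∀ z ∈ U, V z = V' z) (hW : ∀ z ∈ U, W z = W' z)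
    (ha : ∀ z ∈ U, a z = a' z) (hb : ∀ z ∈ U, b z = b' z) {z : E} (hz : z ∈ U) :
    courantForm V W a b z = courantForm V' W' a' b' z := by
  rw [courantForm, courantForm, locLie_congr hU hV hb hz, locLie_congr hU hW ha hz,
    fderiv_congr_of_isOpen hU (fun z hz => by rw [hV z hz, hb z hz]) hz]

lemma courantFun_congr {U : Set E} (hU : IsOpen U) {V V' W W' : E → E} {b b' : E → E →L[ℝ] ℝ}
    {f f' g g' : E → ℝ} (hV : ∀ z ∈ U, V z = V' z) (hW : ∀ z ∈ U, W z = W' z)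
    (hb : ∀ z ∈ U, b z = b' z) (hf : ∀ z ∈ U, f z = f' z) (hg : ∀ z ∈ U, g z = g' z) {z : E}
    (hz : z ∈ U) : courantFun V W b f g z = courantFun V' W' b' f' g' z := by
  rw [courantFun, courantFun, fderiv_congr_of_isOpen hU hf hz, fderiv_congr_of_isOpen hU hg hz,
    hV z hz, hW z hz, hb z hz]

lemma contDiffOn_courantForm {U : Set E} (hU : IsOpen U) {V W : E → E} {a b : E → E →L[ℝ] ℝ}
    (hV : ContDiffOn ℝ ∞ V U) (hW : ContDiffOn ℝ ∞ W U) (ha : ContDiffOn ℝ ∞ a U)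
    (hb : ContDiffOn ℝ ∞ b U) : ContDiffOn ℝ ∞ (courantForm V W a b) U :=
  ((contDiffOn_locLie hU hV hb).sub (contDiffOn_locLie hU hW ha)).sub
    ((hb.clm_apply hV).fderiv_of_isOpen hU le_rfl)

lemma contDiffOn_courantFun {U : Set E} (hU : IsOpen U) {V W : E → E} {b : E → E →L[ℝ] ℝ}
    {f g : E → ℝ} (hV : ContDiffOn ℝ ∞ V U) (hW : ContDiffOn ℝ ∞ W U)
    (hb : ContDiffOn ℝ ∞ b U) (hf : ContDiffOn ℝ ∞ f U) (hg : ContDiffOn ℝ ∞ g U) :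
    ContDiffOn ℝ ∞ (courantFun V W b f g) U :=
  (((hg.fderiv_of_isOpen hU le_rfl).clm_apply hV).sub
    ((hf.fderiv_of_isOpen hU le_rfl).clm_apply hW)).sub (hb.clm_apply hV)

namespace IsLocalJacobi

variable {U : Set E} {L : E → (E →L[ℝ] ℝ) →L[ℝ] E} {R : E → E}
  {a b : E → E →L[ℝ] ℝ} {f g : E → ℝ}

lemma pairing_locAnchor {z : E} (hbR : b z (R z) = 0) :
    b z (locAnchor L R a f z) = b z (L z (a z)) := by
  simp [locAnchor, hbR]

lemma pairing_locAnchor_skew (h : IsLocalJacobi U L R) {z : E} (hz : z ∈ U)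
    (haR : a z (R z) = 0) (hbR : b z (R z) = 0) :
    b z (locAnchor L R a f z) = - a z (locAnchor L R b g z) := by
  rw [pairing_locAnchor hbR, pairing_locAnchor haR, h.skew z hz]

/-- The anchor maps the bracket of sections to the Lie bracket of vector fields. -/
theorem lieBracket_locAnchor (h : IsLocalJacobi U L R)
    (ha : ContDiffOn ℝ ∞ a U) (hb : ContDiffOn ℝ ∞ b U) (hf : ContDiffOn ℝ ∞ f U)
    (hg : ContDiffOn ℝ ∞ g U) (haR : ∀ z ∈ U, a z (R z) = 0) (hbR : ∀ z ∈ U, b z (R z) = 0)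
    {z : E} (hz : z ∈ U) :
    lieBracket ℝ (locAnchor L R a f) (locAnchor L R b g) z
      = locAnchor L R (courantForm (locAnchor L R a f) (locAnchor L R b g) a b)
          (courantFun (locAnchor L R a f) (locAnchor L R b g) b f g) z := by
  have hR' := differentiableAt_of_contDiffOn h.isOpen h.smooth_reeb hz
  have hf' := differentiableAt_of_contDiffOn h.isOpen hf hz
  have hg' := differentiableAt_of_contDiffOn h.isOpen hg hz
  have hLa := differentiableAt_of_contDiffOn h.isOpen (h.contDiffOn_sharp ha) hz
  have hLb := differentiableAt_of_contDiffOn h.isOpen (h.contDiffOn_sharp hb) hz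
  have e1 : lieBracket ℝ (locAnchor L R a f) (locAnchor L R b g) z
      = lieBracket ℝ (fun z => L z (a z)) (fun z => L z (b z)) z
        - g z • lieBracket ℝ R (fun z => L z (a z)) z
        + f z • lieBracket ℝ R (fun z => L z (b z)) z
        + (fderiv ℝ g z (locAnchor L R a f z) - fderiv ℝ f z (locAnchor L R b g z)) • R z := by
    simp only [lieBracket_eq]
    rw [h.fderiv_locAnchor hz ha hf, h.fderiv_locAnchor hz hb hg]
    simp only [locAnchor, map_add, map_smul]
    module
  have e2 : courantForm (locAnchor L R a f) (locAnchor L R b g) a b z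
      = (locLie (fun z => L z (a z)) b z - locLie (fun z => L z (b z)) a z
          - fderiv ℝ (fun z => b z (L z (a z))) z) + f z • locLie R b z - g z • locLie R a z := by
    rw [courantForm, fderiv_congr_of_isOpen h.isOpen
      (fun z hz => pairing_locAnchor (hbR z hz)) hz]
    have e3 : locLie (locAnchor L R a f) b z = _ := locLie_add_smul hLa hR' hf'
    have e4 : locLie (locAnchor L R b g) a z = _ := locLie_add_smul hLb hR' hg'
    rw [e3, e4, haR z hz, hbR z hz]
    module
  rw [e1, h.lieBracket_sharp_sharp hz ha hb (haR z hz) (hbR z hz),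
    h.lieBracket_reeb_sharp hz ha, h.lieBracket_reeb_sharp hz hb]
  conv_rhs => rw [locAnchor, e2, courantFun, pairing_locAnchor (hbR z hz)]
  simp only [map_add, map_sub, map_smul]
  module

/-- One-forms annihilating the Reeb field are preserved by the bracket. -/
theorem courantForm_reeb (h : IsLocalJacobi U L R)
    (ha : ContDiffOn ℝ ∞ a U) (hb : ContDiffOn ℝ ∞ b U) (hf : ContDiffOn ℝ ∞ f U)
    (hg : ContDiffOn ℝ ∞ g U) (haR : ∀ z ∈ U, a z (R z) = 0) (hbR : ∀ z ∈ U, b z (R z) = 0)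
    {z : E} (hz : z ∈ U) :
    courantForm (locAnchor L R a f) (locAnchor L R b g) a b z (R z) = 0 := by
  have hR' := differentiableAt_of_contDiffOn h.isOpen h.smooth_reeb hz
  have ha' := differentiableAt_of_contDiffOn h.isOpen ha hz
  have hb' := differentiableAt_of_contDiffOn h.isOpen hb hz
  have hf' := differentiableAt_of_contDiffOn h.isOpen hf hz
  have hLa := differentiableAt_of_contDiffOn h.isOpen (h.contDiffOn_sharp ha) hz
  have hLb := differentiableAt_of_contDiffOn h.isOpen (h.contDiffOn_sharp hb) hz
  have e0 : ∀ {b : E → E →L[ℝ] ℝ}, (∀ z ∈ U, b z (R z) = 0) →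
      fderiv ℝ (fun z => b z (R z)) z = 0 := fun hbR => by
    rw [fderiv_congr_of_isOpen (g := fun _ => (0 : ℝ)) h.isOpen hbR hz]; simp
  have e1 : ∀ {a b : E → E →L[ℝ] ℝ} {f : E → ℝ}, ContDiffOn ℝ ∞ a U → ContDiffOn ℝ ∞ f U →
      (∀ z ∈ U, b z (R z) = 0) →
      b z (lieBracket ℝ (locAnchor L R a f) R z)
        = - b z (lieBracket ℝ R (fun z => L z (a z)) z) := by
    intro a b f ha hf hbR
    simp only [lieBracket_eq, h.fderiv_locAnchor hz ha hf, map_sub, map_add, map_smul, hbR z hz,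
      locAnchor, smul_eq_mul]
    ring
  rw [courantForm, sub_apply, sub_apply, locLie_apply ha' hR', locLie_apply hb' hR', e0 haR,
    e0 hbR, e1 ha hf hbR, e1 hb hg haR, h.lieBracket_reeb_sharp hz ha, h.skew z hz _ (b z),
    locLie_apply ha' hLb, fderiv_congr_of_isOpen h.isOpen
      (fun z hz => (pairing_locAnchor (hbR z hz)).trans (h.skew z hz _ _)) hz]
  simp

end IsLocalJacobi

/-! ### The Jacobi identity for the Courant bracket on isotropic sections -/

section CourantJacobi

/-- The data of three sections of an integrable isotropic subbundle: the pairs `(V_i, a_i)` are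
isotropic and so are the brackets `[(V_i, a_i), (V_j, a_j)]` with respect to `(V_k, a_k)`. -/
structure IsCourantTriple (U : Set E) (V₁ V₂ V₃ : E → E) (a₁ a₂ a₃ : E → E →L[ℝ] ℝ) : Prop where
  isOpen : IsOpen U
  smooth_V₁ : ContDiffOn ℝ ∞ V₁ U
  smooth_V₂ : ContDiffOn ℝ ∞ V₂ U
  smooth_V₃ : ContDiffOn ℝ ∞ V₃ U
  smooth_a₁ : ContDiffOn ℝ ∞ a₁ U
  smooth_a₂ : ContDiffOn ℝ ∞ a₂ U
  smooth_a₃ : ContDiffOn ℝ ∞ a₃ U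
  skew₁₂ : ∀ z ∈ U, a₂ z (V₁ z) = - a₁ z (V₂ z)
  skew₂₃ : ∀ z ∈ U, a₃ z (V₂ z) = - a₂ z (V₃ z)
  skew₃₁ : ∀ z ∈ U, a₁ z (V₃ z) = - a₃ z (V₁ z)
  inv₁ : ∀ z ∈ U, courantForm V₂ V₃ a₂ a₃ z (V₁ z) = - a₁ z (lieBracket ℝ V₂ V₃ z)
  inv₂ : ∀ z ∈ U, courantForm V₃ V₁ a₃ a₁ z (V₂ z) = - a₂ z (lieBracket ℝ V₃ V₁ z)
  inv₃ : ∀ z ∈ U, courantForm V₁ V₂ a₁ a₂ z (V₃ z) = - a₃ z (lieBracket ℝ V₁ V₂ z)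

namespace IsCourantTriple

variable {U : Set E} {V₁ V₂ V₃ : E → E} {a₁ a₂ a₃ : E → E →L[ℝ] ℝ}

lemma courantForm_apply {V W X : E → E} {a b : E → E →L[ℝ] ℝ} {z : E}
    (ha : DifferentiableAt ℝ a z) (hb : DifferentiableAt ℝ b z) (hX : DifferentiableAt ℝ X z) :
    courantForm V W a b z (X z)
      = fderiv ℝ (fun z => b z (X z)) z (V z) - b z (lieBracket ℝ V X z)
        - (fderiv ℝ (fun z => a z (X z)) z (W z) - a z (lieBracket ℝ W X z))
        - fderiv ℝ (fun z => b z (V z)) z (X z) := by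
  rw [courantForm, sub_apply, sub_apply, locLie_apply hb hX, locLie_apply ha hX]

/-- Comparing the cyclic sum `S` of `V₁(a₃(V₂))` and the cyclic sum `Q` of `a₁([V₂, V₃])`, the
invariance conditions add up to `-Q = 2 Q - 3 S`. -/
lemma cyclic_sum_eq_zero (h : IsCourantTriple U V₁ V₂ V₃ a₁ a₂ a₃) {z : E} (hz : z ∈ U) :
    (fderiv ℝ (fun z => a₃ z (V₂ z)) z (V₁ z) - a₁ z (lieBracket ℝ V₂ V₃ z))
      + (fderiv ℝ (fun z => a₁ z (V₃ z)) z (V₂ z) - a₂ z (lieBracket ℝ V₃ V₁ z))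
      + (fderiv ℝ (fun z => a₂ z (V₁ z)) z (V₃ z) - a₃ z (lieBracket ℝ V₁ V₂ z)) = 0 := by
  have d {F : Type u} [NormedAddCommGroup F] [NormedSpace ℝ F] {f : E → F}
      (hf : ContDiffOn ℝ ∞ f U) := differentiableAt_of_contDiffOn h.isOpen hf hz
  have e₁ := h.inv₁ z hz
  have e₂ := h.inv₂ z hz
  have e₃ := h.inv₃ z hz
  rw [courantForm_apply (d h.smooth_a₂) (d h.smooth_a₃) (d h.smooth_V₁)] at e₁
  rw [courantForm_apply (d h.smooth_a₃) (d h.smooth_a₁) (d h.smooth_V₂)] at e₂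
  rw [courantForm_apply (d h.smooth_a₁) (d h.smooth_a₂) (d h.smooth_V₃)] at e₃
  have s₁ := fderiv_congr_of_isOpen h.isOpen h.skew₁₂ hz
  have s₂ := fderiv_congr_of_isOpen h.isOpen h.skew₂₃ hz
  have s₃ := fderiv_congr_of_isOpen h.isOpen h.skew₃₁ hz
  rw [fderiv_fun_neg] at s₁ s₂ s₃
  have t₁ := DFunLike.congr_fun s₁ (V₃ z)
  have t₂ := DFunLike.congr_fun s₂ (V₁ z)
  have t₃ := DFunLike.congr_fun s₃ (V₂ z)
  simp only [neg_apply] at t₁ t₂ t₃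
  rw [lieBracket_swap (V := V₂) (W := V₁)] at e₁
  rw [lieBracket_swap (V := V₃) (W := V₂)] at e₂
  rw [lieBracket_swap (V := V₁) (W := V₃)] at e₃
  simp only [map_neg] at e₁ e₂ e₃
  linarith

/-- The Jacobi identity for the one-form components. -/
theorem jacobi_form (h : IsCourantTriple U V₁ V₂ V₃ a₁ a₂ a₃) {z : E} (hz : z ∈ U) :
    courantForm V₁ (lieBracket ℝ V₂ V₃) a₁ (courantForm V₂ V₃ a₂ a₃) z
      + courantForm V₂ (lieBracket ℝ V₃ V₁) a₂ (courantForm V₃ V₁ a₃ a₁) z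
      + courantForm V₃ (lieBracket ℝ V₁ V₂) a₃ (courantForm V₁ V₂ a₁ a₂) z = 0 := by
  have hU := h.isOpen
  have c {F : Type u} [NormedAddCommGroup F] [NormedSpace ℝ F] {f : E → F}
      (hf : ContDiffOn ℝ ∞ f U) : ContDiffAt ℝ ∞ f z := hf.contDiffAt (hU.mem_nhds hz)
  have d {F : Type u} [NormedAddCommGroup F] [NormedSpace ℝ F] {f : E → F}
      (hf : ContDiffOn ℝ ∞ f U) := differentiableAt_of_contDiffOn hU hf hz
  have dr {f : E → ℝ} (hf : ContDiffOn ℝ ∞ f U) := differentiableAt_of_contDiffOn hU hf hz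
  have hB : ∀ {V W : E → E}, ContDiffOn ℝ ∞ V U → ContDiffOn ℝ ∞ W U →
      ContDiffOn ℝ ∞ (lieBracket ℝ V W) U := fun hV hW =>
    ((hW.fderiv_of_isOpen hU le_rfl).clm_apply hV).sub
      ((hV.fderiv_of_isOpen hU le_rfl).clm_apply hW)
  -- one term of the cyclic sum, expanded with `L_V d = d V`
  have key : ∀ {V₁ V₂ V₃ : E → E} {a₁ a₂ a₃ : E → E →L[ℝ] ℝ}, ContDiffOn ℝ ∞ V₁ U →
      ContDiffOn ℝ ∞ V₂ U → ContDiffOn ℝ ∞ V₃ U → ContDiffOn ℝ ∞ a₁ U → ContDiffOn ℝ ∞ a₂ U →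
      ContDiffOn ℝ ∞ a₃ U →
      (∀ z ∈ U, courantForm V₂ V₃ a₂ a₃ z (V₁ z) = - a₁ z (lieBracket ℝ V₂ V₃ z)) →
      courantForm V₁ (lieBracket ℝ V₂ V₃) a₁ (courantForm V₂ V₃ a₂ a₃) z
        = locLie V₁ (locLie V₂ a₃) z - locLie V₁ (locLie V₃ a₂) z
          - (locLie V₂ (locLie V₃ a₁) z - locLie V₃ (locLie V₂ a₁) z)
          - fderiv ℝ (fun z => fderiv ℝ (fun z => a₃ z (V₂ z)) z (V₁ z)
              - a₁ z (lieBracket ℝ V₂ V₃ z)) z := by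
    intro V₁ V₂ V₃ a₁ a₂ a₃ hV₁ hV₂ hV₃ ha₁ ha₂ ha₃ hinv
    have hf := ha₃.clm_apply hV₂
    have hdf := hf.fderiv_of_isOpen hU (m := ∞) le_rfl
    have e1 : locLie V₁ (courantForm V₂ V₃ a₂ a₃) z
        = locLie V₁ (locLie V₂ a₃) z - locLie V₁ (locLie V₃ a₂) z
          - locLie V₁ (fderiv ℝ (fun z => a₃ z (V₂ z))) z := by
      have e : courantForm V₂ V₃ a₂ a₃ = fun z => locLie V₂ a₃ z - locLie V₃ a₂ z
        - fderiv ℝ (fun z => a₃ z (V₂ z)) z := rfl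
      have d1 := d (contDiffOn_locLie hU hV₂ ha₃)
      have d2 := d (contDiffOn_locLie hU hV₃ ha₂)
      rw [locLie, e, fderiv_fun_sub (d1.fun_sub d2) (d hdf), fderiv_fun_sub d1 d2]
      ext w
      simp [locLie]
      ring
    have e2 : fderiv ℝ (fun z => courantForm V₂ V₃ a₂ a₃ z (V₁ z)) z
        = - fderiv ℝ (fun z => a₁ z (lieBracket ℝ V₂ V₃ z)) z := by
      rw [fderiv_congr_of_isOpen hU hinv hz, fderiv_fun_neg]
    rw [courantForm, e1, locLie_fderiv (hf.contDiffAt (hU.mem_nhds hz)) (d hV₁), e2,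
      ← locLie_commutator (c ha₁) (c hV₂) (c hV₃),
      fderiv_fun_sub (dr (hdf.clm_apply hV₁)) (dr (ha₁.clm_apply (hB hV₂ hV₃)))]
    abel
  rw [key h.smooth_V₁ h.smooth_V₂ h.smooth_V₃ h.smooth_a₁ h.smooth_a₂ h.smooth_a₃ h.inv₁,
    key h.smooth_V₂ h.smooth_V₃ h.smooth_V₁ h.smooth_a₂ h.smooth_a₃ h.smooth_a₁ h.inv₂,
    key h.smooth_V₃ h.smooth_V₁ h.smooth_V₂ h.smooth_a₃ h.smooth_a₁ h.smooth_a₂ h.inv₃]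
  have hT := fderiv_congr_of_isOpen hU (fun z hz => h.cyclic_sum_eq_zero hz) hz
  have hP : ∀ {V₁ V₂ V₃ : E → E} {a₁ a₃ : E → E →L[ℝ] ℝ}, ContDiffOn ℝ ∞ V₁ U →
      ContDiffOn ℝ ∞ V₂ U → ContDiffOn ℝ ∞ V₃ U → ContDiffOn ℝ ∞ a₁ U → ContDiffOn ℝ ∞ a₃ U →
      DifferentiableAt ℝ (fun z => fderiv ℝ (fun z => a₃ z (V₂ z)) z (V₁ z)
        - a₁ z (lieBracket ℝ V₂ V₃ z)) z := fun hV₁ hV₂ hV₃ ha₁ ha₃ =>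
    dr ((((ha₃.clm_apply hV₂).fderiv_of_isOpen hU le_rfl).clm_apply hV₁).sub
      (ha₁.clm_apply (hB hV₂ hV₃)))
  have p₁ := hP h.smooth_V₁ h.smooth_V₂ h.smooth_V₃ h.smooth_a₁ h.smooth_a₃
  have p₂ := hP h.smooth_V₂ h.smooth_V₃ h.smooth_V₁ h.smooth_a₂ h.smooth_a₁
  have p₃ := hP h.smooth_V₃ h.smooth_V₁ h.smooth_V₂ h.smooth_a₃ h.smooth_a₂
  rw [fderiv_fun_add (p₁.fun_add p₂) p₃, fderiv_fun_add p₁ p₂, fderiv_fun_const] at hT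
  refine Eq.trans ?_ (neg_eq_zero.2 hT)
  abel

/-- The Jacobi identity for the function components. -/
theorem jacobi_fun (h : IsCourantTriple U V₁ V₂ V₃ a₁ a₂ a₃) {f₁ f₂ f₃ : E → ℝ}
    (hf₁ : ContDiffOn ℝ ∞ f₁ U) (hf₂ : ContDiffOn ℝ ∞ f₂ U) (hf₃ : ContDiffOn ℝ ∞ f₃ U)
    {z : E} (hz : z ∈ U) :
    courantFun V₁ (lieBracket ℝ V₂ V₃) (courantForm V₂ V₃ a₂ a₃) f₁ (courantFun V₂ V₃ a₃ f₂ f₃) z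
      + courantFun V₂ (lieBracket ℝ V₃ V₁) (courantForm V₃ V₁ a₃ a₁) f₂
          (courantFun V₃ V₁ a₁ f₃ f₁) z
      + courantFun V₃ (lieBracket ℝ V₁ V₂) (courantForm V₁ V₂ a₁ a₂) f₃
          (courantFun V₁ V₂ a₂ f₁ f₂) z = 0 := by
  have hU := h.isOpen
  have d {F : Type u} [NormedAddCommGroup F] [NormedSpace ℝ F] {f : E → F}
      (hf : ContDiffOn ℝ ∞ f U) := differentiableAt_of_contDiffOn hU hf hz
  have dr {f : E → ℝ} (hf : ContDiffOn ℝ ∞ f U) := differentiableAt_of_contDiffOn hU hf hz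
  have key : ∀ {V₁ V₂ V₃ : E → E} {a₁ a₂ a₃ : E → E →L[ℝ] ℝ} {f₁ f₂ f₃ : E → ℝ},
      ContDiffOn ℝ ∞ V₁ U →
      ContDiffOn ℝ ∞ V₂ U → ContDiffOn ℝ ∞ V₃ U → ContDiffOn ℝ ∞ a₃ U →
      ContDiffOn ℝ ∞ f₁ U → ContDiffOn ℝ ∞ f₂ U → ContDiffOn ℝ ∞ f₃ U →
      (∀ z ∈ U, courantForm V₂ V₃ a₂ a₃ z (V₁ z) = - a₁ z (lieBracket ℝ V₂ V₃ z)) →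
      courantFun V₁ (lieBracket ℝ V₂ V₃) (courantForm V₂ V₃ a₂ a₃) f₁
          (courantFun V₂ V₃ a₃ f₂ f₃) z
        = fderiv ℝ (fun z => fderiv ℝ f₃ z (V₂ z)) z (V₁ z)
          - fderiv ℝ (fun z => fderiv ℝ f₂ z (V₃ z)) z (V₁ z)
          - (fderiv ℝ (fun z => fderiv ℝ f₁ z (V₃ z)) z (V₂ z)
            - fderiv ℝ (fun z => fderiv ℝ f₁ z (V₂ z)) z (V₃ z))
          - (fderiv ℝ (fun z => a₃ z (V₂ z)) z (V₁ z) - a₁ z (lieBracket ℝ V₂ V₃ z)) := by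
    intro V₁ V₂ V₃ a₁ a₂ a₃ f₁ f₂ f₃ hV₁ hV₂ hV₃ ha₃ hf₁ hf₂ hf₃ hinv
    have d1 := dr ((hf₃.fderiv_of_isOpen hU le_rfl).clm_apply hV₂)
    have d2 := dr ((hf₂.fderiv_of_isOpen hU le_rfl).clm_apply hV₃)
    have d3 := dr (ha₃.clm_apply hV₂)
    have e : courantFun V₂ V₃ a₃ f₂ f₃
      = fun z => fderiv ℝ f₃ z (V₂ z) - fderiv ℝ f₂ z (V₃ z) - a₃ z (V₂ z) := rfl
    rw [courantFun, e, fderiv_fun_sub (d1.fun_sub d2) d3, fderiv_fun_sub d1 d2, hinv z hz,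
      fderiv_apply_lieBracket (hf₁.contDiffAt (hU.mem_nhds hz))
        (by simpa using! (mod_cast le_top : ((2 : ℕ∞) : WithTop ℕ∞) ≤ ∞)) (d hV₃) (d hV₂)]
    simp only [sub_apply]
    ring
  rw [key h.smooth_V₁ h.smooth_V₂ h.smooth_V₃ h.smooth_a₃ hf₁ hf₂ hf₃ h.inv₁,
    key h.smooth_V₂ h.smooth_V₃ h.smooth_V₁ h.smooth_a₁ hf₂ hf₃ hf₁ h.inv₂,
    key h.smooth_V₃ h.smooth_V₁ h.smooth_V₂ h.smooth_a₂ hf₃ hf₁ hf₂ h.inv₃]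
  linarith [h.cyclic_sum_eq_zero hz]

end IsCourantTriple

end CourantJacobi

end LocalJacobi

/-! ### Components in charts -/

section ChartCalculus

variable {E : Type*} [NormedAddCommGroup E] [NormedSpace ℝ E]
variable {M : Type*} [TopologicalSpace M] [ChartedSpace E M]

lemma isOpen_chartTarget (x₀ : M) : IsOpen (chartTarget (E := E) x₀) :=
  isOpen_extChartAt_target x₀

lemma chartInv_mem_source {x₀ : M} {y : E} (hy : y ∈ chartTarget x₀) :
    chartInv x₀ y ∈ (chartAt E x₀).source := by
  rw [← extChartAt_source 𝓘(ℝ, E)]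
  exact (extChartAt 𝓘(ℝ, E) x₀).map_target hy

lemma extChartAt_mem_chartTarget {x₀ x : M} (hx : x ∈ (chartAt E x₀).source) :
    extChartAt 𝓘(ℝ, E) x₀ x ∈ chartTarget (E := E) x₀ :=
  (extChartAt 𝓘(ℝ, E) x₀).map_source (by rwa [extChartAt_source])

lemma extChartAt_chartInv {x₀ : M} {y : E} (hy : y ∈ chartTarget x₀) :
    extChartAt 𝓘(ℝ, E) x₀ (chartInv x₀ y) = y :=
  (extChartAt 𝓘(ℝ, E) x₀).right_inv hy

lemma chartInv_extChartAt {x₀ x : M} (hx : x ∈ (chartAt E x₀).source) :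
    chartInv x₀ (extChartAt 𝓘(ℝ, E) x₀ x) = x :=
  (extChartAt 𝓘(ℝ, E) x₀).left_inv (by rwa [extChartAt_source])

lemma function_ext {f g : M → ℝ}
    (h : ∀ x₀ : M, ∀ y ∈ chartTarget (E := E) x₀, f (chartInv x₀ y) = g (chartInv x₀ y)) :
    f = g := by
  funext x
  have := h x _ (extChartAt_mem_chartTarget (mem_chart_source E x))
  rwa [chartInv_extChartAt (mem_chart_source E x)] at this

variable (M) in
/-- A one-form with smooth components in every chart. -/
def IsSmoothForm (α : OneForm E M) : Prop :=
  ∀ x₀ : M, ContDiffOn ℝ ∞ (oneFormRep x₀ α) (chartTarget x₀)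

variable (E) in
/-- A function which is smooth in every chart. -/
def IsSmoothFun (f : M → ℝ) : Prop :=
  ∀ x₀ : M, ContDiffOn ℝ ∞ (fun y : E => f (chartInv x₀ y)) (chartTarget x₀)

/-- A vector field with smooth components in every chart. -/
def IsSmoothVec (V : VField E M) : Prop :=
  ∀ x₀ : M, ContDiffOn ℝ ∞ (vectorRep x₀ V) (chartTarget x₀)

lemma eventually_chartInv_extChartAt {x₀ x : M} (hx : x ∈ (chartAt E x₀).source) :
    ∀ᶠ x' in nhds x, chartInv x₀ (extChartAt 𝓘(ℝ, E) x₀ x') = x' :=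
  Filter.eventually_of_mem ((chartAt E x₀).open_source.mem_nhds hx)
    fun _ h => chartInv_extChartAt h

lemma IsSmoothFun.differentiableAt {f : M → ℝ} (hf : IsSmoothFun E f) {x₀ : M} {y : E}
    (hy : y ∈ chartTarget x₀) : DifferentiableAt ℝ (fun y : E => f (chartInv x₀ y)) y :=
  differentiableAt_of_contDiffOn (isOpen_chartTarget x₀) (hf x₀) hy

variable [IsManifold 𝓘(ℝ, E) ∞ M]

lemma isManifold_one : IsManifold 𝓘(ℝ, E) 1 M := IsManifold.of_le (n := ∞) (by simp)

attribute [local instance] isManifold_one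

lemma mdifferentiableAt_chartInv {x₀ : M} {y : E} (hy : y ∈ chartTarget x₀) :
    MDifferentiableAt 𝓘(ℝ, E) 𝓘(ℝ, E) (chartInv (E := E) x₀) y := by
  have h := mdifferentiableWithinAt_extChartAt_symm (I := 𝓘(ℝ, E)) (x := x₀) hy
  rwa [modelWithCornersSelf_coe, range_id, mdifferentiableWithinAt_univ] at h

lemma mdifferentiableAt_chart {x₀ x : M} (hx : x ∈ (chartAt E x₀).source) :
    MDifferentiableAt 𝓘(ℝ, E) 𝓘(ℝ, E) (extChartAt 𝓘(ℝ, E) x₀) x :=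
  mdifferentiableAt_extChartAt hx

lemma mfderiv_chartInv_mfderiv_chart {x₀ : M} {y : E} (hy : y ∈ chartTarget x₀)
    (v : TangentSpace 𝓘(ℝ, E) (chartInv x₀ y)) :
    mfderiv 𝓘(ℝ, E) 𝓘(ℝ, E) (chartInv (E := E) x₀) y
      (mfderiv 𝓘(ℝ, E) 𝓘(ℝ, E) (extChartAt 𝓘(ℝ, E) x₀) (chartInv x₀ y) v) = v := by
  have h := mfderivWithin_extChartAt_symm_comp_mfderiv_extChartAt (I := 𝓘(ℝ, E)) (x := x₀) hy
  rw [modelWithCornersSelf_coe, range_id, mfderivWithin_univ] at h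
  exact DFunLike.congr_fun h v

/-- A one-form is evaluated on a vector through the components of both in a chart. -/
lemma oneFormRep_vectorRep {x₀ : M} {y : E} (hy : y ∈ chartTarget x₀) (α : OneForm E M)
    (V : VField E M) :
    oneFormRep x₀ α y (vectorRep x₀ V y) = α (chartInv x₀ y) (V (chartInv x₀ y)) := by
  simp only [oneFormRep, vectorRep]
  exact congrArg _ (mfderiv_chartInv_mfderiv_chart hy _)

lemma oneFormRep_mfderiv_chart {x₀ : M} {y : E} (hy : y ∈ chartTarget x₀) (α : OneForm E M)
    (v : TangentSpace 𝓘(ℝ, E) (chartInv x₀ y)) :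
    oneFormRep x₀ α y
      (mfderiv 𝓘(ℝ, E) 𝓘(ℝ, E) (extChartAt 𝓘(ℝ, E) x₀) (chartInv x₀ y) v)
      = α (chartInv x₀ y) v := by
  simp only [oneFormRep]
  exact congrArg _ (mfderiv_chartInv_mfderiv_chart hy _)

lemma mfderiv_chart_self (x : M) :
    mfderiv 𝓘(ℝ, E) 𝓘(ℝ, E) (extChartAt 𝓘(ℝ, E) x) x = ContinuousLinearMap.id ℝ _ :=
  mfderiv_extChartAt_self

lemma oneFormRep_self (x : M) (α : OneForm E M) :
    oneFormRep x α (extChartAt 𝓘(ℝ, E) x x) = α x := by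
  have hx := mem_chart_source E x
  have hy := extChartAt_mem_chartTarget hx
  ext v
  have h := oneFormRep_mfderiv_chart hy α
  rw [chartInv_extChartAt hx, mfderiv_chart_self] at h
  exact h v

lemma oneForm_ext {α β : OneForm E M}
    (h : ∀ x₀ : M, ∀ y ∈ chartTarget x₀, oneFormRep x₀ α y = oneFormRep x₀ β y) : α = β := by
  funext x
  rw [← oneFormRep_self x α, ← oneFormRep_self x β]
  exact h x _ (extChartAt_mem_chartTarget (mem_chart_source E x))

lemma mdifferentiableAt_of_rep {f : M → ℝ} {x₀ : M} {y : E} (hy : y ∈ chartTarget x₀)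
    (hf : DifferentiableAt ℝ (fun y : E => f (chartInv x₀ y)) y) :
    MDifferentiableAt 𝓘(ℝ, E) 𝓘(ℝ, ℝ) f (chartInv x₀ y) := by
  have hx := chartInv_mem_source hy
  have h1 : MDifferentiableAt 𝓘(ℝ, E) 𝓘(ℝ, ℝ) (fun y : E => f (chartInv x₀ y))
      (extChartAt 𝓘(ℝ, E) x₀ (chartInv x₀ y)) := by
    rw [extChartAt_chartInv hy]
    exact hf.mdifferentiableAt
  refine (h1.comp (chartInv x₀ y) (mdifferentiableAt_chart hx)).congr_of_eventuallyEq ?_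
  filter_upwards [eventually_chartInv_extChartAt hx] with x' hx'
  exact congrArg f hx'.symm

lemma oneFormRep_dFun {f : M → ℝ} {x₀ : M} {y : E} (hy : y ∈ chartTarget x₀)
    (hf : DifferentiableAt ℝ (fun y : E => f (chartInv x₀ y)) y) :
    oneFormRep x₀ (dFun f) y = fderiv ℝ (fun y : E => f (chartInv x₀ y)) y := by
  have h := mfderiv_comp y (mdifferentiableAt_of_rep hy hf) (mdifferentiableAt_chartInv hy)
  rw [← mfderiv_eq_fderiv]
  exact h.symm

lemma IsSmoothFun.dFun {f : M → ℝ} (hf : IsSmoothFun E f) : IsSmoothForm M (dFun (E := E) f) :=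
  fun x₀ => ((hf x₀).fderiv_of_isOpen (isOpen_chartTarget x₀) le_rfl).congr
    fun _ hy => oneFormRep_dFun hy (hf.differentiableAt hy)

lemma contDiffAt_chart_chartInv {x₀ x : M} {y : E} (hy : y ∈ chartTarget x₀)
    (hx : chartInv x₀ y ∈ (chartAt E x).source) :
    ContDiffAt ℝ ∞ (fun z : E => extChartAt 𝓘(ℝ, E) x (chartInv x₀ z)) y := by
  rw [← contMDiffAt_iff_contDiffAt]
  have h1 : ContMDiffAt 𝓘(ℝ, E) 𝓘(ℝ, E) ∞ (extChartAt 𝓘(ℝ, E) x) (chartInv x₀ y) :=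
    contMDiffAt_extChartAt' hx
  have h2 : ContMDiffAt 𝓘(ℝ, E) 𝓘(ℝ, E) ∞ (chartInv (E := E) x₀) y :=
    (contMDiffOn_extChartAt_symm (I := 𝓘(ℝ, E)) (n := ∞) x₀).contMDiffAt
      ((isOpen_chartTarget x₀).mem_nhds hy)
  exact h1.comp y h2

/-- The derivative of a transition map. -/
lemma fderiv_chart_chartInv {x₀ x : M} {y : E} (hy : y ∈ chartTarget x₀)
    (hx : chartInv x₀ y ∈ (chartAt E x).source) (v : E) :
    fderiv ℝ (fun z : E => extChartAt 𝓘(ℝ, E) x (chartInv x₀ z)) y v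
      = mfderiv 𝓘(ℝ, E) 𝓘(ℝ, E) (extChartAt 𝓘(ℝ, E) x) (chartInv x₀ y)
          (mfderiv 𝓘(ℝ, E) 𝓘(ℝ, E) (chartInv (E := E) x₀) y v) := by
  have h := mfderiv_comp y (mdifferentiableAt_chart hx) (mdifferentiableAt_chartInv hy)
  rw [← mfderiv_eq_fderiv]
  exact DFunLike.congr_fun h v

lemma fderiv_chart_vectorRep {x₀ x : M} {y : E} (hy : y ∈ chartTarget x₀)
    (hx : chartInv x₀ y ∈ (chartAt E x).source) (V : VField E M) :
    fderiv ℝ (fun z : E => extChartAt 𝓘(ℝ, E) x (chartInv x₀ z)) y (vectorRep x₀ V y)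
      = vectorRep x V (extChartAt 𝓘(ℝ, E) x (chartInv x₀ y)) := by
  rw [fderiv_chart_chartInv hy hx, vectorRep, vectorRep, chartInv_extChartAt hx]
  exact congrArg _ (mfderiv_chartInv_mfderiv_chart hy _)

lemma oneFormRep_change {x₀ x : M} {y : E} (hy : y ∈ chartTarget x₀)
    (hx : chartInv x₀ y ∈ (chartAt E x).source) (α : OneForm E M) :
    oneFormRep x₀ α y = (oneFormRep x α (extChartAt 𝓘(ℝ, E) x (chartInv x₀ y))).comp
      (fderiv ℝ (fun z : E => extChartAt 𝓘(ℝ, E) x (chartInv x₀ z)) y) := by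
  ext v
  rw [ContinuousLinearMap.comp_apply, fderiv_chart_chartInv hy hx]
  have h := oneFormRep_mfderiv_chart (extChartAt_mem_chartTarget hx) α
  rw [chartInv_extChartAt hx] at h
  exact (h _).symm

/-- The Lie derivative is given by the coordinate formula in every chart. -/
theorem oneFormRep_lieDeriv {V : VField E M} {α : OneForm E M} (hV : IsSmoothVec V)
    (hα : IsSmoothForm M α) {x₀ : M} {y : E} (hy : y ∈ chartTarget x₀) :
    oneFormRep x₀ (lieDeriv V α) y = locLie (vectorRep x₀ V) (oneFormRep x₀ α) y := by
  set x := chartInv x₀ y with hxdef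
  have hx : chartInv x₀ y ∈ (chartAt E x).source := mem_chart_source E x
  have ho : IsOpen (chartTarget x₀ ∩ chartInv (E := E) x₀ ⁻¹' (chartAt E x).source) :=
    ((contMDiffOn_extChartAt_symm (I := 𝓘(ℝ, E)) (n := ∞) x₀).continuousOn).isOpen_inter_preimage
      (isOpen_chartTarget x₀) (chartAt E x).open_source
  have ht := extChartAt_mem_chartTarget hx
  have hn := locLie_natural ho ⟨hy, hx⟩ (contDiffAt_chart_chartInv hy hx)
    (differentiableAt_of_contDiffOn (isOpen_chartTarget x₀) (hV x₀) hy)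
    (differentiableAt_of_contDiffOn (isOpen_chartTarget x) (hV x) ht)
    (differentiableAt_of_contDiffOn (isOpen_chartTarget x) (hα x) ht)
    (fun z hz => fderiv_chart_vectorRep hz.1 hz.2 V) (fun z hz => oneFormRep_change hz.1 hz.2 α)
  rw [hn]
  ext v
  rw [ContinuousLinearMap.comp_apply, fderiv_chart_chartInv hy hx, ← hxdef, mfderiv_chart_self]
  rfl

lemma onReeb_chartInv (J : JacobiStructure E M) (α : OneForm E M) {x₀ : M} {y : E}
    (hy : y ∈ chartTarget x₀) :
    J.onReeb α (chartInv x₀ y) = oneFormRep x₀ α y (vectorRep x₀ J.reeb y) :=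
  (oneFormRep_vectorRep hy _ _).symm

lemma contMDiff_isSmoothFun {f : M → ℝ} (hf : ContMDiff 𝓘(ℝ, E) 𝓘(ℝ, ℝ) ∞ f) :
    IsSmoothFun E f := fun x₀ =>
  (hf.comp_contMDiffOn (contMDiffOn_extChartAt_symm (I := 𝓘(ℝ, E)) (n := ∞) x₀)).contDiffOn

end ChartCalculus

/-! ### The Kerbrat–Vaisman bracket in charts -/

section JacobiCharts

variable {E : Type*} [NormedAddCommGroup E] [NormedSpace ℝ E] [FiniteDimensional ℝ E]
variable {M : Type*} [TopologicalSpace M] [ChartedSpace E M]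

/-- The components of `♯` in the preferred chart at `x₀`, as a continuous linear map depending on
the point. -/
def localSharp (J : JacobiStructure E M) (x₀ : M) (y : E) : (E →L[ℝ] ℝ) →L[ℝ] E :=
  LinearMap.toContinuousLinearMap
    { toFun := fun a => sharpRep x₀ J.sharp a y
      map_add' := fun a b => by
        let ψ := mfderiv 𝓘(ℝ, E) 𝓘(ℝ, E) (extChartAt 𝓘(ℝ, E) x₀) (chartInv x₀ y)
        exact (congrArg ψ ((J.sharp (chartInv x₀ y)).map_add (a.comp ψ) (b.comp ψ))).trans
          (ψ.map_add _ _)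
      map_smul' := fun c a => by
        let ψ := mfderiv 𝓘(ℝ, E) 𝓘(ℝ, E) (extChartAt 𝓘(ℝ, E) x₀) (chartInv x₀ y)
        exact (congrArg ψ ((J.sharp (chartInv x₀ y)).map_smul c (a.comp ψ))).trans
          (ψ.map_smul _ _) }

lemma localSharp_apply (J : JacobiStructure E M) (x₀ : M) (y : E) (a : E →L[ℝ] ℝ) :
    localSharp J x₀ y a = sharpRep x₀ J.sharp a y := rfl

lemma localSharp_skew (J : JacobiStructure E M) (x₀ : M) (y : E) (a b : E →L[ℝ] ℝ) :
    b (localSharp J x₀ y a) = - a (localSharp J x₀ y b) :=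
  J.sharp_skew (chartInv x₀ y)
    (a.comp (mfderiv 𝓘(ℝ, E) 𝓘(ℝ, E) (extChartAt 𝓘(ℝ, E) x₀) (chartInv x₀ y)))
    (b.comp (mfderiv 𝓘(ℝ, E) 𝓘(ℝ, E) (extChartAt 𝓘(ℝ, E) x₀) (chartInv x₀ y)))

lemma contDiffOn_localSharp (J : JacobiStructure E M) (x₀ : M) :
    ContDiffOn ℝ ∞ (localSharp J x₀) (chartTarget x₀) :=
  contDiffOn_clm_apply.2 fun a => J.sharp_smooth x₀ a

lemma fderiv_localSharp (J : JacobiStructure E M) {x₀ : M} {y : E} (hy : y ∈ chartTarget x₀)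
    (b c : E →L[ℝ] ℝ) (v : E) :
    fderiv ℝ (fun z => c (sharpRep x₀ J.sharp b z)) y v = c (fderiv ℝ (localSharp J x₀) y v b) := by
  have hL := differentiableAt_of_contDiffOn (isOpen_chartTarget x₀) (contDiffOn_localSharp J x₀) hy
  have h : HasFDerivAt (fun z => c (localSharp J x₀ z b)) _ y :=
    c.hasFDerivAt.comp y (hL.hasFDerivAt.clm_apply (hasFDerivAt_const b y))
  have e : (fun z => c (sharpRep x₀ J.sharp b z)) = fun z => c (localSharp J x₀ z b) := rfl
  rw [e, h.fderiv]
  simp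

/-- The components of a Jacobi structure in a chart. -/
theorem isLocalJacobi (J : JacobiStructure E M) (x₀ : M) :
    IsLocalJacobi (chartTarget x₀) (localSharp J x₀) (vectorRep x₀ J.reeb) where
  isOpen := isOpen_chartTarget x₀
  skew := fun y _ a b => localSharp_skew J x₀ y a b
  smooth := contDiffOn_localSharp J x₀
  smooth_reeb := J.reeb_smooth x₀
  schouten := fun y hy a b c => by
    have h := J.schouten_self x₀ y hy a b c
    simpa only [fderiv_localSharp J hy, localSharp_apply] using h
  lie_reeb := fun y hy a b => by
    have hR := differentiableAt_of_contDiffOn (isOpen_chartTarget x₀) (J.reeb_smooth x₀) hy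
    have e : ∀ (c : E →L[ℝ] ℝ) (v : E), fderiv ℝ (fun z => c (vectorRep x₀ J.reeb z)) y v
        = c (fderiv ℝ (vectorRep x₀ J.reeb) y v) := fun c v => by
      have h : HasFDerivAt (fun z => c (vectorRep x₀ J.reeb z)) _ y :=
        c.hasFDerivAt.comp y hR.hasFDerivAt
      rw [h.fderiv]
      rfl
    have h := J.lie_reeb x₀ y hy a b
    rw [fderiv_localSharp J hy, e, e, map_neg, map_neg, sub_neg_eq_add] at h
    exact h

variable [IsManifold 𝓘(ℝ, E) ∞ M]

lemma vectorRep_sharpField (J : JacobiStructure E M) (α : OneForm E M) {x₀ : M} {y : E}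
    (hy : y ∈ chartTarget x₀) :
    vectorRep x₀ (J.sharpField α) y = localSharp J x₀ y (oneFormRep x₀ α y) := by
  rw [localSharp_apply, sharpRep, vectorRep, JacobiStructure.sharpField]
  congr 2
  ext v
  exact (oneFormRep_mfderiv_chart hy α v).symm

lemma lam_chartInv (J : JacobiStructure E M) (α β : OneForm E M) {x₀ : M} {y : E}
    (hy : y ∈ chartTarget x₀) :
    J.lam α β (chartInv x₀ y) = oneFormRep x₀ β y (localSharp J x₀ y (oneFormRep x₀ α y)) := by
  rw [← vectorRep_sharpField J α hy, oneFormRep_vectorRep hy]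
  rfl

lemma isSmoothVec_sharpField (J : JacobiStructure E M) {α : OneForm E M}
    (hα : IsSmoothForm M α) : IsSmoothVec (J.sharpField α) := fun x₀ =>
  ((isLocalJacobi J x₀).contDiffOn_sharp (hα x₀)).congr
    fun _ hy => vectorRep_sharpField J α hy

lemma isSmoothFun_lam (J : JacobiStructure E M) {α β : OneForm E M} (hα : IsSmoothForm M α)
    (hβ : IsSmoothForm M β) : IsSmoothFun E (J.lam α β) := fun x₀ =>
  ((hβ x₀).clm_apply ((isLocalJacobi J x₀).contDiffOn_sharp (hα x₀))).congr
    fun _ hy => lam_chartInv J α β hy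

/-- The one-form component of the Kerbrat–Vaisman bracket in a chart. -/
theorem oneFormRep_kvBracket (J : JacobiStructure E M) {p q : JetSection E M}
    (hp : IsSmoothForm M p.1) (hq : IsSmoothForm M q.1) {x₀ : M} {y : E}
    (hy : y ∈ chartTarget x₀) :
    oneFormRep x₀ (kvBracket J p q).1 y
      = locLie (fun z => localSharp J x₀ z (oneFormRep x₀ p.1 z)) (oneFormRep x₀ q.1) y
        - locLie (fun z => localSharp J x₀ z (oneFormRep x₀ q.1 z)) (oneFormRep x₀ p.1) y
        - fderiv ℝ (fun z => oneFormRep x₀ q.1 z (localSharp J x₀ z (oneFormRep x₀ p.1 z))) y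
        + p.2 (chartInv x₀ y) • locLie (vectorRep x₀ J.reeb) (oneFormRep x₀ q.1) y
        - q.2 (chartInv x₀ y) • locLie (vectorRep x₀ J.reeb) (oneFormRep x₀ p.1) y
        - oneFormRep x₀ p.1 y (vectorRep x₀ J.reeb y) • oneFormRep x₀ q.1 y
        + oneFormRep x₀ q.1 y (vectorRep x₀ J.reeb y) • oneFormRep x₀ p.1 y := by
  have h : oneFormRep x₀ (kvBracket J p q).1 y
      = oneFormRep x₀ (lieDeriv (J.sharpField p.1) q.1) y
        - oneFormRep x₀ (lieDeriv (J.sharpField q.1) p.1) y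
        - oneFormRep x₀ (dFun (J.lam p.1 q.1)) y
        + p.2 (chartInv x₀ y) • oneFormRep x₀ (lieDeriv J.reeb q.1) y
        - q.2 (chartInv x₀ y) • oneFormRep x₀ (lieDeriv J.reeb p.1) y
        - J.onReeb p.1 (chartInv x₀ y) • oneFormRep x₀ q.1 y
        + J.onReeb q.1 (chartInv x₀ y) • oneFormRep x₀ p.1 y := rfl
  have hU := isOpen_chartTarget (E := E) x₀
  rw [h, oneFormRep_lieDeriv (isSmoothVec_sharpField J hp) hq hy,
    oneFormRep_lieDeriv (isSmoothVec_sharpField J hq) hp hy,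
    oneFormRep_lieDeriv J.reeb_smooth hq hy, oneFormRep_lieDeriv J.reeb_smooth hp hy,
    oneFormRep_dFun hy ((isSmoothFun_lam J hp hq).differentiableAt hy),
    onReeb_chartInv J _ hy, onReeb_chartInv J _ hy,
    fderiv_congr_of_isOpen hU (fun z hz => lam_chartInv J p.1 q.1 hz) hy,
    locLie_congr hU (fun z hz => vectorRep_sharpField J p.1 hz) (fun _ _ => rfl) hy,
    locLie_congr hU (fun z hz => vectorRep_sharpField J q.1 hz) (fun _ _ => rfl) hy]

/-- On 1-jets of functions the Kerbrat–Vaisman bracket is the 1-jet of the Jacobi bracket. -/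
theorem kvBracket_jet (J : JacobiStructure E M) {f g : M → ℝ} (hf : IsSmoothFun E f)
    (hg : IsSmoothFun E g) : kvBracket J (jet f) (jet g) = jet (jacobiBracket J f g) := by
  refine Prod.ext (oneForm_ext fun x₀ y hy => ?_) (funext fun x => ?_)
  · have hU := isOpen_chartTarget (E := E) x₀
    have hJ := isLocalJacobi J x₀
    have d {f : E → ℝ} (hf : ContDiffOn ℝ ∞ f (chartTarget x₀)) :=
      differentiableAt_of_contDiffOn hU hf hy
    have hR := differentiableAt_of_contDiffOn hU hJ.smooth_reeb hy
    have ha := (hf x₀).fderiv_of_isOpen (m := ∞) hU le_rfl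
    have hb := (hg x₀).fderiv_of_isOpen (m := ∞) hU le_rfl
    have hLa := hJ.contDiffOn_sharp ha
    have hLb := hJ.contDiffOn_sharp hb
    have ea : ∀ z ∈ chartTarget x₀, oneFormRep x₀ (dFun (E := E) f) z
        = fderiv ℝ (fun y => f (chartInv x₀ y)) z :=
      fun z hz => oneFormRep_dFun hz (hf.differentiableAt hz)
    have eb : ∀ z ∈ chartTarget x₀, oneFormRep x₀ (dFun (E := E) g) z
        = fderiv ℝ (fun y => g (chartInv x₀ y)) z :=
      fun z hz => oneFormRep_dFun hz (hg.differentiableAt hz)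
    have ej : ∀ z ∈ chartTarget (E := E) x₀, jacobiBracket J f g (chartInv x₀ z)
        = fderiv ℝ (fun y => g (chartInv x₀ y)) z
            (localSharp J x₀ z (fderiv ℝ (fun y => f (chartInv x₀ y)) z))
          + f (chartInv x₀ z) * fderiv ℝ (fun y => g (chartInv x₀ y)) z (vectorRep x₀ J.reeb z)
          - g (chartInv x₀ z)
            * fderiv ℝ (fun y => f (chartInv x₀ y)) z (vectorRep x₀ J.reeb z) := by
      intro z hz
      rw [jacobiBracket, lam_chartInv J _ _ hz, onReeb_chartInv J _ hz, onReeb_chartInv J _ hz,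
        ea z hz, eb z hz]
    have d1 := d (hb.clm_apply hLa)
    have d2 := (d (hf x₀)).fun_mul (d (hb.clm_apply hJ.smooth_reeb))
    have d3 := (d (hg x₀)).fun_mul (d (ha.clm_apply hJ.smooth_reeb))
    have hj : DifferentiableAt ℝ (fun y : E => jacobiBracket J f g (chartInv x₀ y)) y :=
      ((d1.fun_add d2).fun_sub d3).congr_of_eventuallyEq
        (Filter.eventually_of_mem (hU.mem_nhds hy) ej)
    have hfy := (hf x₀).contDiffAt (hU.mem_nhds hy)
    have hgy := (hg x₀).contDiffAt (hU.mem_nhds hy)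
    -- Every Lie derivative of an exact form is exact (`locLie_fderiv`), and by skewness of `♯` the
    -- three differentials of `±Λ(df, dg)` add up to a single one.
    rw [oneFormRep_kvBracket J hf.dFun hg.dFun hy]
    simp only [jet]
    rw [oneFormRep_dFun hy hj, fderiv_congr_of_isOpen hU ej hy,
      fderiv_fun_sub (d1.fun_add d2) d3, fderiv_fun_add d1 d2,
      fderiv_fun_mul (d (hf x₀)) (d (hb.clm_apply hJ.smooth_reeb)),
      fderiv_fun_mul (d (hg x₀)) (d (ha.clm_apply hJ.smooth_reeb)), ea y hy, eb y hy,
      locLie_congr hU (fun z hz => congrArg (localSharp J x₀ z) (ea z hz)) eb hy,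
      locLie_congr hU (fun z hz => congrArg (localSharp J x₀ z) (eb z hz)) ea hy,
      locLie_congr hU (fun _ _ => rfl) ea hy, locLie_congr hU (fun _ _ => rfl) eb hy,
      fderiv_congr_of_isOpen hU (fun z hz => by rw [ea z hz, eb z hz]) hy,
      locLie_fderiv hgy (differentiableAt_of_contDiffOn hU hLa hy),
      locLie_fderiv hfy (differentiableAt_of_contDiffOn hU hLb hy),
      locLie_fderiv hgy hR, locLie_fderiv hfy hR,
      fderiv_congr_of_isOpen hU (f := fun z => fderiv ℝ (fun y => f (chartInv x₀ y)) z
        (localSharp J x₀ z (fderiv ℝ (fun y => g (chartInv x₀ y)) z)))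
        (fun z hz => localSharp_skew J x₀ z _ _) hy, fderiv_fun_neg]
    module
  · simp [kvBracket, jet, JacobiStructure.lam]

end JacobiCharts

/-! ### Sections of the 1-jet bundle annihilating the Reeb field -/

section GaugeSections

open VectorField IsLocalJacobi

variable {E : Type*} [NormedAddCommGroup E] [NormedSpace ℝ E]
variable {M : Type*} [TopologicalSpace M] [ChartedSpace E M]

/-- A smooth section `(α, f)` of the 1-jet bundle with `α(E) = 0`. -/
structure IsGaugeSection (J : JacobiStructure E M) (p : JetSection E M) : Prop where
  form : IsSmoothForm M p.1
  fn : IsSmoothFun E p.2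
  reeb : ∀ x : M, p.1 x (J.reeb x) = 0

lemma oneFormRep_add (x₀ : M) (α β : OneForm E M) (y : E) :
    oneFormRep x₀ (α + β) y = oneFormRep x₀ α y + oneFormRep x₀ β y := rfl

lemma oneFormRep_smul (x₀ : M) (c : ℝ) (α : OneForm E M) (y : E) :
    oneFormRep x₀ (c • α) y = c • oneFormRep x₀ α y := rfl

lemma oneFormRep_neg (x₀ : M) (α : OneForm E M) (y : E) :
    oneFormRep x₀ (-α) y = - oneFormRep x₀ α y := rfl

variable {J : JacobiStructure E M} {p q r : JetSection E M}

lemma IsGaugeSection.add (hp : IsGaugeSection J p) (hq : IsGaugeSection J q) :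
    IsGaugeSection J (p + q) where
  form x₀ := (hp.form x₀).add (hq.form x₀)
  fn x₀ := (hp.fn x₀).add (hq.fn x₀)
  reeb x := by
    have h : (p + q).1 x (J.reeb x) = p.1 x (J.reeb x) + q.1 x (J.reeb x) := rfl
    rw [h, hp.reeb, hq.reeb, add_zero]

lemma IsGaugeSection.smul (c : ℝ) (hp : IsGaugeSection J p) : IsGaugeSection J (c • p) where
  form x₀ := (hp.form x₀).const_smul c
  fn x₀ := (hp.fn x₀).const_smul c
  reeb x := by
    have h : (c • p).1 x (J.reeb x) = c * p.1 x (J.reeb x) := rfl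
    rw [h, hp.reeb, mul_zero]

lemma IsGaugeSection.rep_reeb [IsManifold 𝓘(ℝ, E) ∞ M] (hp : IsGaugeSection J p) {x₀ : M} {y : E}
    (hy : y ∈ chartTarget x₀) : oneFormRep x₀ p.1 y (vectorRep x₀ J.reeb y) = 0 := by
  rw [oneFormRep_vectorRep hy, hp.reeb]

variable [FiniteDimensional ℝ E]

/-- The anchor `♯α + f E` of a section `p = (α, f)` in the preferred chart at `x₀`. -/
def anchorRep (J : JacobiStructure E M) (x₀ : M) (p : JetSection E M) : E → E :=
  locAnchor (localSharp J x₀) (vectorRep x₀ J.reeb) (oneFormRep x₀ p.1)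
    (fun y => p.2 (chartInv x₀ y))

lemma anchorRep_add (x₀ : M) (p q : JetSection E M) (y : E) :
    anchorRep J x₀ (p + q) y = anchorRep J x₀ p y + anchorRep J x₀ q y := by
  simp only [anchorRep, locAnchor, Prod.fst_add, Prod.snd_add, oneFormRep_add, Pi.add_apply,
    map_add]
  module

lemma anchorRep_smul (x₀ : M) (c : ℝ) (p : JetSection E M) (y : E) :
    anchorRep J x₀ (c • p) y = c • anchorRep J x₀ p y := by
  simp only [anchorRep, locAnchor, Prod.smul_fst, Prod.smul_snd, oneFormRep_smul, Pi.smul_apply,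
    map_smul, smul_eq_mul]
  module

lemma IsGaugeSection.contDiffOn_anchorRep (hp : IsGaugeSection J p) (x₀ : M) :
    ContDiffOn ℝ ∞ (anchorRep J x₀ p) (chartTarget x₀) :=
  (isLocalJacobi J x₀).contDiffOn_locAnchor (hp.form x₀) (hp.fn x₀)

variable [IsManifold 𝓘(ℝ, E) ∞ M]

lemma IsGaugeSection.pairing_skew (hp : IsGaugeSection J p) (hq : IsGaugeSection J q) {x₀ : M}
    {y : E} (hy : y ∈ chartTarget x₀) :
    oneFormRep x₀ q.1 y (anchorRep J x₀ p y) = - oneFormRep x₀ p.1 y (anchorRep J x₀ q y) :=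
  (isLocalJacobi J x₀).pairing_locAnchor_skew hy (hp.rep_reeb hy) (hq.rep_reeb hy)

/-- On sections annihilating the Reeb field the one-form component of the Kerbrat–Vaisman bracket
is that of the Courant bracket of the pairs `(♯α + f E, α)`. -/
theorem IsGaugeSection.rep_bracket_fst (hp : IsGaugeSection J p) (hq : IsGaugeSection J q)
    {x₀ : M} {y : E} (hy : y ∈ chartTarget x₀) :
    oneFormRep x₀ (kvBracket J p q).1 y = courantForm (anchorRep J x₀ p) (anchorRep J x₀ q)
      (oneFormRep x₀ p.1) (oneFormRep x₀ q.1) y := by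
  have hU := isOpen_chartTarget (E := E) x₀
  have hJ := isLocalJacobi J x₀
  have hR := differentiableAt_of_contDiffOn hU hJ.smooth_reeb hy
  have e3 : locLie (anchorRep J x₀ p) (oneFormRep x₀ q.1) y = _ :=
    locLie_add_smul (differentiableAt_of_contDiffOn hU (hJ.contDiffOn_sharp (hp.form x₀)) hy) hR
      (hp.fn.differentiableAt hy)
  have e4 : locLie (anchorRep J x₀ q) (oneFormRep x₀ p.1) y = _ :=
    locLie_add_smul (differentiableAt_of_contDiffOn hU (hJ.contDiffOn_sharp (hq.form x₀)) hy) hR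
      (hq.fn.differentiableAt hy)
  have e5 : ∀ z ∈ chartTarget x₀, oneFormRep x₀ q.1 z (anchorRep J x₀ p z) = _ :=
    fun z hz => pairing_locAnchor (hq.rep_reeb hz)
  rw [oneFormRep_kvBracket J hp.form hq.form hy, courantForm, e3, e4, hp.rep_reeb hy,
    hq.rep_reeb hy, fderiv_congr_of_isOpen hU e5 hy]
  module

theorem IsGaugeSection.rep_bracket_snd (hp : IsGaugeSection J p) (hq : IsGaugeSection J q)
    {x₀ : M} {y : E} (hy : y ∈ chartTarget x₀) :
    (kvBracket J p q).2 (chartInv x₀ y) = courantFun (anchorRep J x₀ p) (anchorRep J x₀ q)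
      (oneFormRep x₀ q.1) (fun y => p.2 (chartInv x₀ y)) (fun y => q.2 (chartInv x₀ y)) y := by
  have h1 : ∀ α β γ δ : OneForm E M, J.lam (α - β) (γ - δ) (chartInv x₀ y)
      = J.lam α γ (chartInv x₀ y) - J.lam α δ (chartInv x₀ y) - J.lam β γ (chartInv x₀ y)
        + J.lam β δ (chartInv x₀ y) := by
    intro α β γ δ
    simp only [lam_chartInv J _ _ hy, sub_eq_add_neg, oneFormRep_add, oneFormRep_neg, map_add,
      map_neg, add_apply, neg_apply]
    ring
  simp only [kvBracket, jacobiBracket, h1, lam_chartInv J _ _ hy, onReeb_chartInv J _ hy,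
    oneFormRep_dFun hy (hp.fn.differentiableAt hy), oneFormRep_dFun hy (hq.fn.differentiableAt hy),
    courantFun, anchorRep, pairing_locAnchor (hq.rep_reeb hy)]
  simp only [locAnchor, map_add, map_smul, smul_eq_mul]
  rw [localSharp_skew J x₀ y (fderiv ℝ (fun y => p.2 (chartInv x₀ y)) y) (oneFormRep x₀ q.1 y)]
  ring

/-- The Kerbrat–Vaisman bracket preserves the smooth sections annihilating the Reeb field. -/
theorem IsGaugeSection.bracket (hp : IsGaugeSection J p) (hq : IsGaugeSection J q) :
    IsGaugeSection J (kvBracket J p q) where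
  form x₀ := (contDiffOn_courantForm (isOpen_chartTarget x₀) (hp.contDiffOn_anchorRep x₀)
    (hq.contDiffOn_anchorRep x₀) (hp.form x₀) (hq.form x₀)).congr
      fun _ hy => hp.rep_bracket_fst hq hy
  fn x₀ := (contDiffOn_courantFun (isOpen_chartTarget x₀) (hp.contDiffOn_anchorRep x₀)
    (hq.contDiffOn_anchorRep x₀) (hq.form x₀) (hp.fn x₀) (hq.fn x₀)).congr
      fun _ hy => hp.rep_bracket_snd hq hy
  reeb := by
    refine congrFun (function_ext (E := E) (g := 0) fun x₀ y hy => ?_)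
    rw [← oneFormRep_vectorRep hy, hp.rep_bracket_fst hq hy]
    exact (isLocalJacobi J x₀).courantForm_reeb (hp.form x₀) (hq.form x₀) (hp.fn x₀) (hq.fn x₀)
      (fun _ hz => hp.rep_reeb hz) (fun _ hz => hq.rep_reeb hz) hy

/-- The anchor is a homomorphism from the Kerbrat–Vaisman bracket to the Lie bracket. -/
theorem IsGaugeSection.lieBracket_anchorRep (hp : IsGaugeSection J p) (hq : IsGaugeSection J q)
    {x₀ : M} {y : E} (hy : y ∈ chartTarget x₀) :
    lieBracket ℝ (anchorRep J x₀ p) (anchorRep J x₀ q) y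
      = anchorRep J x₀ (kvBracket J p q) y := by
  conv_rhs => rw [anchorRep, locAnchor, hp.rep_bracket_fst hq hy, hp.rep_bracket_snd hq hy]
  exact (isLocalJacobi J x₀).lieBracket_locAnchor (hp.form x₀) (hq.form x₀) (hp.fn x₀) (hq.fn x₀)
    (fun _ hz => hp.rep_reeb hz) (fun _ hz => hq.rep_reeb hz) hy

lemma IsGaugeSection.isCourantTriple (hp : IsGaugeSection J p) (hq : IsGaugeSection J q)
    (hr : IsGaugeSection J r) (x₀ : M) :
    IsCourantTriple (chartTarget x₀) (anchorRep J x₀ p) (anchorRep J x₀ q) (anchorRep J x₀ r)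
      (oneFormRep x₀ p.1) (oneFormRep x₀ q.1) (oneFormRep x₀ r.1) := by
  have key : ∀ {p q r : JetSection E M}, IsGaugeSection J p → IsGaugeSection J q →
      IsGaugeSection J r → ∀ z ∈ chartTarget x₀,
      courantForm (anchorRep J x₀ q) (anchorRep J x₀ r) (oneFormRep x₀ q.1) (oneFormRep x₀ r.1) z
        (anchorRep J x₀ p z)
        = - oneFormRep x₀ p.1 z (lieBracket ℝ (anchorRep J x₀ q) (anchorRep J x₀ r) z) := by
    intro p q r hp hq hr z hz
    rw [← hq.rep_bracket_fst hr hz, hq.lieBracket_anchorRep hr hz,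
      hp.pairing_skew (hq.bracket hr) hz]
  exact
    { isOpen := isOpen_chartTarget x₀
      smooth_V₁ := hp.contDiffOn_anchorRep x₀
      smooth_V₂ := hq.contDiffOn_anchorRep x₀
      smooth_V₃ := hr.contDiffOn_anchorRep x₀
      smooth_a₁ := hp.form x₀
      smooth_a₂ := hq.form x₀
      smooth_a₃ := hr.form x₀
      skew₁₂ := fun z hz => hp.pairing_skew hq hz
      skew₂₃ := fun z hz => hq.pairing_skew hr hz
      skew₃₁ := fun z hz => hr.pairing_skew hp hz
      inv₁ := key hp hq hr
      inv₂ := key hq hr hp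
      inv₃ := key hr hp hq }

/-- The Jacobi identity for the Kerbrat–Vaisman bracket. -/
theorem IsGaugeSection.jacobi (hp : IsGaugeSection J p) (hq : IsGaugeSection J q)
    (hr : IsGaugeSection J r) :
    kvBracket J p (kvBracket J q r) + kvBracket J q (kvBracket J r p)
      + kvBracket J r (kvBracket J p q) = 0 := by
  refine Prod.ext (oneForm_ext fun x₀ y hy => ?_) (function_ext (E := E) fun x₀ y hy => ?_)
  · have hU := isOpen_chartTarget (E := E) x₀
    have key : ∀ {p q r : JetSection E M}, IsGaugeSection J p → IsGaugeSection J q →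
        IsGaugeSection J r → oneFormRep x₀ (kvBracket J p (kvBracket J q r)).1 y
          = courantForm (anchorRep J x₀ p) (lieBracket ℝ (anchorRep J x₀ q) (anchorRep J x₀ r))
            (oneFormRep x₀ p.1) (courantForm (anchorRep J x₀ q) (anchorRep J x₀ r)
              (oneFormRep x₀ q.1) (oneFormRep x₀ r.1)) y := fun hp hq hr => by
      rw [hp.rep_bracket_fst (hq.bracket hr) hy]
      exact courantForm_congr hU (fun _ _ => rfl)
        (fun z hz => (hq.lieBracket_anchorRep hr hz).symm) (fun _ _ => rfl)
        (fun z hz => hq.rep_bracket_fst hr hz) hy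
    rw [Prod.fst_add, Prod.fst_add, oneFormRep_add, oneFormRep_add, key hp hq hr, key hq hr hp,
      key hr hp hq]
    exact (hp.isCourantTriple hq hr x₀).jacobi_form hy
  · have hU := isOpen_chartTarget (E := E) x₀
    have key : ∀ {p q r : JetSection E M}, IsGaugeSection J p → IsGaugeSection J q →
        IsGaugeSection J r → (kvBracket J p (kvBracket J q r)).2 (chartInv x₀ y)
          = courantFun (anchorRep J x₀ p) (lieBracket ℝ (anchorRep J x₀ q) (anchorRep J x₀ r))
            (courantForm (anchorRep J x₀ q) (anchorRep J x₀ r)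
              (oneFormRep x₀ q.1) (oneFormRep x₀ r.1)) (fun y => p.2 (chartInv x₀ y))
            (courantFun (anchorRep J x₀ q) (anchorRep J x₀ r) (oneFormRep x₀ r.1)
              (fun y => q.2 (chartInv x₀ y)) (fun y => r.2 (chartInv x₀ y))) y :=
      fun hp hq hr => by
      rw [hp.rep_bracket_snd (hq.bracket hr) hy]
      exact courantFun_congr hU (fun _ _ => rfl)
        (fun z hz => (hq.lieBracket_anchorRep hr hz).symm)
        (fun z hz => hq.rep_bracket_fst hr hz) (fun _ _ => rfl)
        (fun z hz => hq.rep_bracket_snd hr hz) hy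
    rw [Prod.snd_add, Prod.snd_add, Pi.add_apply, Pi.add_apply, key hp hq hr, key hq hr hp,
      key hr hp hq]
    exact (hp.isCourantTriple hq hr x₀).jacobi_fun (hp.fn x₀) (hq.fn x₀) (hr.fn x₀) hy

lemma IsGaugeSection.bracket_skew (hp : IsGaugeSection J p) (hq : IsGaugeSection J q) :
    kvBracket J q p = - kvBracket J p q := by
  refine Prod.ext (oneForm_ext fun x₀ y hy => ?_) (function_ext (E := E) fun x₀ y hy => ?_)
  · rw [Prod.fst_neg, oneFormRep_neg, hp.rep_bracket_fst hq hy, hq.rep_bracket_fst hp hy,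
      courantForm, courantForm,
      fderiv_congr_of_isOpen (isOpen_chartTarget x₀) (fun z hz => hp.pairing_skew hq hz) hy,
      fderiv_fun_neg]
    abel
  · rw [Prod.snd_neg, Pi.neg_apply, hp.rep_bracket_snd hq hy, hq.rep_bracket_snd hp hy,
      courantFun, courantFun, hp.pairing_skew hq hy]
    ring

lemma IsGaugeSection.bracket_add (hp : IsGaugeSection J p) (hq : IsGaugeSection J q)
    (hr : IsGaugeSection J r) :
    kvBracket J (p + q) r = kvBracket J p r + kvBracket J q r := by
  refine Prod.ext (oneForm_ext fun x₀ y hy => ?_) (function_ext (E := E) fun x₀ y hy => ?_)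
  · have hU := isOpen_chartTarget (E := E) x₀
    have hV := differentiableAt_of_contDiffOn hU (hp.contDiffOn_anchorRep x₀) hy
    have hW := differentiableAt_of_contDiffOn hU (hq.contDiffOn_anchorRep x₀) hy
    have ha := differentiableAt_of_contDiffOn hU (hp.form x₀) hy
    have hb := differentiableAt_of_contDiffOn hU (hq.form x₀) hy
    have hc := differentiableAt_of_contDiffOn hU (hr.form x₀) hy
    have e1 : anchorRep J x₀ (p + q) = fun y => anchorRep J x₀ p y + anchorRep J x₀ q y :=
      funext (anchorRep_add x₀ p q)
    have e2 : oneFormRep x₀ (p + q).1 = fun y => oneFormRep x₀ p.1 y + oneFormRep x₀ q.1 y := rfl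
    rw [Prod.fst_add, oneFormRep_add, (hp.add hq).rep_bracket_fst hr hy,
      hp.rep_bracket_fst hr hy, hq.rep_bracket_fst hr hy, e1, e2]
    simp only [courantForm, locLie, map_add]
    rw [fderiv_fun_add hV hW, fderiv_fun_add ha hb,
      fderiv_fun_add (hc.clm_apply hV) (hc.clm_apply hW)]
    simp only [add_apply, ContinuousLinearMap.add_comp, ContinuousLinearMap.comp_add]
    abel
  · rw [Prod.snd_add, Pi.add_apply, (hp.add hq).rep_bracket_snd hr hy,
      hp.rep_bracket_snd hr hy, hq.rep_bracket_snd hr hy]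
    have e : (fun y : E => (p + q).2 (chartInv x₀ y))
      = fun y => p.2 (chartInv x₀ y) + q.2 (chartInv x₀ y) := rfl
    simp only [courantFun, anchorRep_add, map_add, e]
    rw [fderiv_fun_add (hp.fn.differentiableAt hy) (hq.fn.differentiableAt hy)]
    simp only [add_apply]
    ring

lemma IsGaugeSection.bracket_smul (c : ℝ) (hp : IsGaugeSection J p) (hr : IsGaugeSection J r) :
    kvBracket J (c • p) r = c • kvBracket J p r := by
  refine Prod.ext (oneForm_ext fun x₀ y hy => ?_) (function_ext (E := E) fun x₀ y hy => ?_)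
  · have hU := isOpen_chartTarget (E := E) x₀
    have hV := differentiableAt_of_contDiffOn hU (hp.contDiffOn_anchorRep x₀) hy
    have ha := differentiableAt_of_contDiffOn hU (hp.form x₀) hy
    have hc := differentiableAt_of_contDiffOn hU (hr.form x₀) hy
    have e1 : anchorRep J x₀ (c • p) = fun y => c • anchorRep J x₀ p y :=
      funext (anchorRep_smul x₀ c p)
    have e2 : oneFormRep x₀ (c • p).1 = fun y => c • oneFormRep x₀ p.1 y := rfl
    rw [Prod.smul_fst, oneFormRep_smul, (hp.smul c).rep_bracket_fst hr hy,
      hp.rep_bracket_fst hr hy, e1, e2]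
    simp only [courantForm, locLie, map_smul]
    rw [fderiv_fun_const_smul hV, fderiv_fun_const_smul ha,
      fderiv_fun_const_smul (hc.clm_apply hV)]
    simp only [smul_apply, ContinuousLinearMap.smul_comp, ContinuousLinearMap.comp_smul]
    module
  · rw [Prod.smul_snd, Pi.smul_apply, (hp.smul c).rep_bracket_snd hr hy,
      hp.rep_bracket_snd hr hy]
    have e : (fun y : E => (c • p).2 (chartInv x₀ y)) = fun y => c • p.2 (chartInv x₀ y) := rfl
    simp only [courantFun, anchorRep_smul, map_smul, e]
    rw [fderiv_fun_const_smul (hp.fn.differentiableAt hy)]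
    simp only [smul_apply, smul_eq_mul]
    ring

end GaugeSections

/-! ### Paths of sections -/

section Paths

open VectorField IsLocalJacobi

variable {E : Type*} [NormedAddCommGroup E] [NormedSpace ℝ E]

lemma uniqueDiffOn_Icc_prod {U : Set E} (hU : IsOpen U) :
    UniqueDiffOn ℝ (Icc (0 : ℝ) 1 ×ˢ U) :=
  (uniqueDiffOn_Icc zero_lt_one).prod hU.uniqueDiffOn

/-- The partial derivative in the second variable is smooth up to the boundary of the
interval. -/
lemma contDiffOn_fderiv_snd {F : Type*} [NormedAddCommGroup F] [NormedSpace ℝ F] {U : Set E}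
    (hU : IsOpen U) {f : ℝ → E → F}
    (hf : ContDiffOn ℝ ∞ (fun z : ℝ × E => f z.1 z.2) (Icc (0 : ℝ) 1 ×ˢ U)) :
    ContDiffOn ℝ ∞ (fun z : ℝ × E => fderiv ℝ (f z.1) z.2) (Icc (0 : ℝ) 1 ×ˢ U) := by
  have h1 := (hf.fderivWithin (uniqueDiffOn_Icc_prod hU) (m := ∞) le_rfl).clm_comp
    (contDiffOn_const (c := ContinuousLinearMap.inr ℝ ℝ E))
  refine h1.congr fun z hz => ?_
  obtain ⟨u, y⟩ := z
  have h2 := ((hf (u, y) hz).differentiableWithinAt (by simp)).hasFDerivWithinAt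
  have h3 : HasFDerivWithinAt (fun y => (u, y)) (ContinuousLinearMap.inr ℝ ℝ E) U y :=
    (hasFDerivAt_prodMk_right u y).hasFDerivWithinAt
  have h4 := h2.comp y h3 fun y hy => ⟨hz.1, hy⟩
  exact (h4.hasFDerivAt (hU.mem_nhds hz.2)).fderiv

lemma contDiffOn_slice {F : Type*} [NormedAddCommGroup F] [NormedSpace ℝ F] {U : Set E}
    {f : ℝ × E → F} (hf : ContDiffOn ℝ ∞ f (Icc (0 : ℝ) 1 ×ˢ U)) {u : ℝ}
    (hu : u ∈ Icc (0 : ℝ) 1) : ContDiffOn ℝ ∞ (fun y => f (u, y)) U :=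
  hf.comp (contDiffOn_const.prodMk contDiffOn_id) fun _ hy => ⟨hu, hy⟩

lemma contDiffOn_snd_comp {F : Type*} [NormedAddCommGroup F] [NormedSpace ℝ F] {U : Set E}
    {f : E → F} (hf : ContDiffOn ℝ ∞ f U) :
    ContDiffOn ℝ ∞ (fun z : ℝ × E => f z.2) (Icc (0 : ℝ) 1 ×ˢ U) :=
  hf.comp contDiffOn_snd fun _ hz => hz.2

lemma contDiffOn_locLie_path {U : Set E} (hU : IsOpen U) {V : ℝ → E → E}
    {a : ℝ → E → E →L[ℝ] ℝ}
    (hV : ContDiffOn ℝ ∞ (fun z : ℝ × E => V z.1 z.2) (Icc (0 : ℝ) 1 ×ˢ U))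
    (ha : ContDiffOn ℝ ∞ (fun z : ℝ × E => a z.1 z.2) (Icc (0 : ℝ) 1 ×ˢ U)) :
    ContDiffOn ℝ ∞ (fun z : ℝ × E => locLie (V z.1) (a z.1) z.2) (Icc (0 : ℝ) 1 ×ˢ U) :=
  ((contDiffOn_fderiv_snd hU ha).clm_apply hV).add
    (ha.clm_comp (contDiffOn_fderiv_snd hU hV))

lemma contDiffOn_courantForm_path {U : Set E} (hU : IsOpen U) {V W : ℝ → E → E}
    {a b : ℝ → E → E →L[ℝ] ℝ}
    (hV : ContDiffOn ℝ ∞ (fun z : ℝ × E => V z.1 z.2) (Icc (0 : ℝ) 1 ×ˢ U))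
    (hW : ContDiffOn ℝ ∞ (fun z : ℝ × E => W z.1 z.2) (Icc (0 : ℝ) 1 ×ˢ U))
    (ha : ContDiffOn ℝ ∞ (fun z : ℝ × E => a z.1 z.2) (Icc (0 : ℝ) 1 ×ˢ U))
    (hb : ContDiffOn ℝ ∞ (fun z : ℝ × E => b z.1 z.2) (Icc (0 : ℝ) 1 ×ˢ U)) :
    ContDiffOn ℝ ∞ (fun z : ℝ × E => courantForm (V z.1) (W z.1) (a z.1) (b z.1) z.2)
      (Icc (0 : ℝ) 1 ×ˢ U) :=
  ((contDiffOn_locLie_path hU hV hb).sub (contDiffOn_locLie_path hU hW ha)).sub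
    (contDiffOn_fderiv_snd hU (f := fun u y => b u y (V u y)) (hb.clm_apply hV))

lemma contDiffOn_courantFun_path {U : Set E} (hU : IsOpen U) {V W : ℝ → E → E}
    {b : ℝ → E → E →L[ℝ] ℝ} {f g : ℝ → E → ℝ}
    (hV : ContDiffOn ℝ ∞ (fun z : ℝ × E => V z.1 z.2) (Icc (0 : ℝ) 1 ×ˢ U))
    (hW : ContDiffOn ℝ ∞ (fun z : ℝ × E => W z.1 z.2) (Icc (0 : ℝ) 1 ×ˢ U))
    (hb : ContDiffOn ℝ ∞ (fun z : ℝ × E => b z.1 z.2) (Icc (0 : ℝ) 1 ×ˢ U))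
    (hf : ContDiffOn ℝ ∞ (fun z : ℝ × E => f z.1 z.2) (Icc (0 : ℝ) 1 ×ˢ U))
    (hg : ContDiffOn ℝ ∞ (fun z : ℝ × E => g z.1 z.2) (Icc (0 : ℝ) 1 ×ˢ U)) :
    ContDiffOn ℝ ∞ (fun z : ℝ × E => courantFun (V z.1) (W z.1) (b z.1) (f z.1) (g z.1) z.2)
      (Icc (0 : ℝ) 1 ×ˢ U) :=
  (((contDiffOn_fderiv_snd hU hg).clm_apply hV).sub
    ((contDiffOn_fderiv_snd hU hf).clm_apply hW)).sub (hb.clm_apply hV)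

variable {M : Type*} [TopologicalSpace M] [ChartedSpace E M]
variable {J : JacobiStructure E M} {p q : JetPath E M}

lemma IsGaugeParameter.isGaugeSection (hp : IsGaugeParameter J p) {u : ℝ}
    (hu : u ∈ Icc (0 : ℝ) 1) : IsGaugeSection J (p u) where
  form x₀ := contDiffOn_slice (hp.smooth x₀).1 hu
  fn x₀ := contDiffOn_slice (hp.smooth x₀).2 hu
  reeb := hp.reeb u hu

lemma IsGaugeParameter.zero : IsGaugeParameter J (0 : JetPath E M) where
  smooth _ := ⟨contDiffOn_const (c := 0), contDiffOn_const (c := 0)⟩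
  reeb _ _ _ := rfl
  left := rfl
  right := rfl

lemma IsGaugeParameter.add (hp : IsGaugeParameter J p) (hq : IsGaugeParameter J q) :
    IsGaugeParameter J (p + q) where
  smooth x₀ := ⟨(hp.smooth x₀).1.add (hq.smooth x₀).1, (hp.smooth x₀).2.add (hq.smooth x₀).2⟩
  reeb _ hu := ((hp.isGaugeSection hu).add (hq.isGaugeSection hu)).reeb
  left := by rw [Pi.add_apply, Prod.fst_add, hp.left, hq.left, add_zero]
  right := by rw [Pi.add_apply, Prod.fst_add, hp.right, hq.right, add_zero]

lemma IsGaugeParameter.smul (c : ℝ) (hp : IsGaugeParameter J p) :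
    IsGaugeParameter J (c • p) where
  smooth x₀ := ⟨(hp.smooth x₀).1.const_smul c, (hp.smooth x₀).2.const_smul c⟩
  reeb _ hu := ((hp.isGaugeSection hu).smul c).reeb
  left := by rw [Pi.smul_apply, Prod.smul_fst, hp.left, smul_zero]
  right := by rw [Pi.smul_apply, Prod.smul_fst, hp.right, smul_zero]

variable [FiniteDimensional ℝ E]

lemma IsGaugeParameter.contDiffOn_anchorRep (hp : IsGaugeParameter J p) (x₀ : M) :
    ContDiffOn ℝ ∞ (fun z : ℝ × E => anchorRep J x₀ (p z.1) z.2)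
      (Icc (0 : ℝ) 1 ×ˢ chartTarget x₀) :=
  ((contDiffOn_snd_comp (contDiffOn_localSharp J x₀)).clm_apply (hp.smooth x₀).1).add
    ((hp.smooth x₀).2.smul (contDiffOn_snd_comp (J.reeb_smooth x₀)))

variable [IsManifold 𝓘(ℝ, E) ∞ M]

lemma kvBracket_fst_eq_zero {P Q : JetSection E M} (hP : IsGaugeSection J P)
    (hQ : IsGaugeSection J Q) (hP0 : P.1 = 0) (hQ0 : Q.1 = 0) : (kvBracket J P Q).1 = 0 := by
  refine oneForm_ext fun x₀ y hy => ?_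
  have e : oneFormRep x₀ (0 : OneForm E M) = fun _ => 0 := rfl
  rw [hP.rep_bracket_fst hQ hy, hP0, hQ0, e]
  simp [courantForm, locLie]

/-- The gauge parameters are closed under the Kerbrat–Vaisman bracket. -/
theorem IsGaugeParameter.bracket (hp : IsGaugeParameter J p) (hq : IsGaugeParameter J q) :
    IsGaugeParameter J (pathBracket J p q) where
  smooth x₀ := by
    have h1 := contDiffOn_courantForm_path (isOpen_chartTarget x₀)
      (V := fun u => anchorRep J x₀ (p u)) (W := fun u => anchorRep J x₀ (q u))
      (a := fun u => oneFormRep x₀ (p u).1) (b := fun u => oneFormRep x₀ (q u).1)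
      (hp.contDiffOn_anchorRep x₀) (hq.contDiffOn_anchorRep x₀) (hp.smooth x₀).1 (hq.smooth x₀).1
    have h2 := contDiffOn_courantFun_path (isOpen_chartTarget x₀)
      (V := fun u => anchorRep J x₀ (p u)) (W := fun u => anchorRep J x₀ (q u))
      (b := fun u => oneFormRep x₀ (q u).1) (f := fun u y => (p u).2 (chartInv x₀ y))
      (g := fun u y => (q u).2 (chartInv x₀ y))
      (hp.contDiffOn_anchorRep x₀) (hq.contDiffOn_anchorRep x₀) (hq.smooth x₀).1 (hp.smooth x₀).2
      (hq.smooth x₀).2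
    exact ⟨h1.congr fun _ hz =>
        (hp.isGaugeSection hz.1).rep_bracket_fst (hq.isGaugeSection hz.1) hz.2,
      h2.congr fun _ hz =>
        (hp.isGaugeSection hz.1).rep_bracket_snd (hq.isGaugeSection hz.1) hz.2⟩
  reeb _ hu := ((hp.isGaugeSection hu).bracket (hq.isGaugeSection hu)).reeb
  left := kvBracket_fst_eq_zero (hp.isGaugeSection (by simp)) (hq.isGaugeSection (by simp))
    hp.left hq.left
  right := kvBracket_fst_eq_zero (hp.isGaugeSection (by simp)) (hq.isGaugeSection (by simp))
    hp.right hq.right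

end Paths

/-! ### First variation of the generating functionals in coordinates -/

section VariationCalculus

/-- Differentiation under the integral sign for a function which is smooth up to the boundary of
the domain of integration. -/
lemma hasDerivAt_integral_of_contDiffOn {G : ℝ × ℝ → ℝ}
    (hG : ContDiffOn ℝ ∞ G (univ ×ˢ Icc (0 : ℝ) 1)) :
    IntervalIntegrable (fun u => deriv (fun s => G (s, u)) 0) volume 0 1 ∧
    HasDerivAt (fun s => ∫ u in (0 : ℝ)..1, G (s, u))
      (∫ u in (0 : ℝ)..1, deriv (fun s => G (s, u)) 0) 0 := by
  set S : Set (ℝ × ℝ) := univ ×ˢ Icc (0 : ℝ) 1 with hS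
  have hud : UniqueDiffOn ℝ S := uniqueDiffOn_univ.prod (uniqueDiffOn_Icc zero_lt_one)
  have hc : ContinuousOn (fun z => fderivWithin ℝ G S z (1, 0)) S :=
    (hG.continuousOn_fderivWithin hud (by simp)).clm_apply continuousOn_const
  have hd : ∀ s, ∀ u ∈ Icc (0 : ℝ) 1,
      HasDerivAt (fun s => G (s, u)) (fderivWithin ℝ G S (s, u) (1, 0)) s := by
    intro s u hu
    have h1 := ((hG (s, u) ⟨mem_univ _, hu⟩).differentiableWithinAt (by simp)).hasFDerivWithinAt
    have h2 : HasDerivWithinAt (fun s : ℝ => (s, u)) ((1 : ℝ), (0 : ℝ)) univ s :=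
      ((hasDerivAt_id s).prodMk (hasDerivAt_const s u)).hasDerivWithinAt
    exact (h1.comp_hasDerivWithinAt (t := S) s h2
      (fun _ _ => mk_mem_prod (mem_univ _) hu)).hasDerivAt Filter.univ_mem
  have hslice : ∀ s : ℝ, ContinuousOn (fun u : ℝ => (s, u)) (Icc (0 : ℝ) 1) := fun s => by fun_prop
  have hI : uIoc (0 : ℝ) 1 ⊆ Icc 0 1 := by
    rw [uIoc_of_le zero_le_one]; exact Ioc_subset_Icc_self
  have hmeas : ∀ {f : ℝ → ℝ}, ContinuousOn f (Icc 0 1) →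
      AEStronglyMeasurable f (volume.restrict (uIoc (0 : ℝ) 1)) := fun hf =>
    (hf.mono hI).aestronglyMeasurable measurableSet_uIoc
  -- The dominating function is the maximum of the `s`-derivative over `[-1, 1] × [0, 1]`.
  obtain ⟨C, hC⟩ := (isCompact_Icc.prod isCompact_Icc).exists_bound_of_continuousOn
    (hc.mono (prod_mono_left (subset_univ (Icc (-1 : ℝ) 1))))
  have key := intervalIntegral.hasDerivAt_integral_of_dominated_loc_of_deriv_le (μ := volume)
    (a := (0 : ℝ)) (b := 1) (F := fun s u => G (s, u))
    (F' := fun s u => fderivWithin ℝ G S (s, u) (1, 0)) (x₀ := (0 : ℝ)) (s := Icc (-1) 1)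
    (bound := fun _ => C) (Icc_mem_nhds (by norm_num) (by norm_num))
    (Filter.Eventually.of_forall fun s =>
      hmeas (hG.continuousOn.comp (hslice s) fun u hu => ⟨mem_univ _, hu⟩))
    ((hG.continuousOn.comp (hslice 0) fun u hu => ⟨mem_univ _, hu⟩).intervalIntegrable_of_Icc
      zero_le_one)
    (hmeas (hc.comp (hslice 0) fun u hu => ⟨mem_univ _, hu⟩))
    (Filter.Eventually.of_forall fun u hu s hs => hC (s, u) ⟨hs, hI hu⟩)
    intervalIntegrable_const
    (Filter.Eventually.of_forall fun u hu s _ => hd s u (hI hu))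
  have he : ∀ u ∈ uIoc (0 : ℝ) 1,
      fderivWithin ℝ G S (0, u) (1, 0) = deriv (fun s => G (s, u)) 0 :=
    fun u hu => (hd 0 u (hI hu)).deriv.symm
  refine ⟨key.1.congr (fun u hu => he u hu), ?_⟩
  rw [← intervalIntegral.integral_congr_ae (Filter.Eventually.of_forall he)]
  exact key.2

variable {E : Type*} [NormedAddCommGroup E] [NormedSpace ℝ E]

/-- The first variation of `a(u, ξ)(∂_u ξ) + η(V(u, ξ))`, with the derivative of `δξ` along the
path removed by subtracting the total derivative of `a(u, ξ)(∂_s ξ)`. -/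
lemma first_variation {a : ℝ × E → E →L[ℝ] ℝ} {V : ℝ × E → E} {ξ : ℝ × ℝ → E}
    {η : ℝ × ℝ → E →L[ℝ] ℝ} {u : ℝ} (ha : DifferentiableAt ℝ a (u, ξ (0, u)))
    (hV : DifferentiableAt ℝ V (u, ξ (0, u))) (hξ : ContDiffAt ℝ ∞ ξ (0, u))
    (hη : DifferentiableAt ℝ η (0, u)) :
    deriv (fun s => a (u, ξ (s, u)) (fderiv ℝ ξ (s, u) (0, 1)) + η (s, u) (V (u, ξ (s, u)))) 0
      - deriv (fun u => a (u, ξ (0, u)) (fderiv ℝ ξ (0, u) (1, 0))) u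
      = fderiv ℝ η (0, u) (1, 0) (V (u, ξ (0, u)))
        + (fderiv ℝ a (u, ξ (0, u)) (0, fderiv ℝ ξ (0, u) (1, 0)) (fderiv ℝ ξ (0, u) (0, 1))
          - fderiv ℝ a (u, ξ (0, u)) (1, fderiv ℝ ξ (0, u) (0, 1)) (fderiv ℝ ξ (0, u) (1, 0))
          + η (0, u) (fderiv ℝ V (u, ξ (0, u)) (0, fderiv ℝ ξ (0, u) (1, 0)))) := by
  have hs : HasDerivAt (fun s : ℝ => (s, u)) ((1 : ℝ), (0 : ℝ)) 0 :=
    (hasDerivAt_id (0 : ℝ)).prodMk (hasDerivAt_const _ u)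
  have hu : HasDerivAt (fun u : ℝ => ((0 : ℝ), u)) ((0 : ℝ), (1 : ℝ)) u :=
    (hasDerivAt_const u (0 : ℝ)).prodMk (hasDerivAt_id u)
  have hξ1 := (hξ.differentiableAt (by simp)).hasFDerivAt
  have hξ2 := (differentiableAt_fderiv hξ).hasFDerivAt
  have hξs : HasDerivAt (fun s => ξ (s, u)) (fderiv ℝ ξ (0, u) (1, 0)) 0 :=
    hξ1.comp_hasDerivAt (0 : ℝ) hs
  have hξu : HasDerivAt (fun u => ξ (0, u)) (fderiv ℝ ξ (0, u) (0, 1)) u :=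
    hξ1.comp_hasDerivAt u hu
  have hξss : HasDerivAt (fun s => fderiv ℝ ξ (s, u)) (fderiv ℝ (fderiv ℝ ξ) (0, u) (1, 0)) 0 :=
    hξ2.comp_hasDerivAt (0 : ℝ) hs
  have hξuu : HasDerivAt (fun u => fderiv ℝ ξ (0, u)) (fderiv ℝ (fderiv ℝ ξ) (0, u) (0, 1)) u :=
    hξ2.comp_hasDerivAt u hu
  have hηs : HasDerivAt (fun s => η (s, u)) (fderiv ℝ η (0, u) (1, 0)) 0 :=
    hη.hasFDerivAt.comp_hasDerivAt (0 : ℝ) hs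
  have hps : HasDerivAt (fun s => (u, ξ (s, u))) ((0 : ℝ), fderiv ℝ ξ (0, u) (1, 0)) 0 :=
    (hasDerivAt_const _ u).prodMk hξs
  have hpu : HasDerivAt (fun u => (u, ξ (0, u))) ((1 : ℝ), fderiv ℝ ξ (0, u) (0, 1)) u :=
    (hasDerivAt_id u).prodMk hξu
  have has : HasDerivAt (fun s => a (u, ξ (s, u)))
      (fderiv ℝ a (u, ξ (0, u)) (0, fderiv ℝ ξ (0, u) (1, 0))) 0 :=
    HasFDerivAt.comp_hasDerivAt (l := a) (0 : ℝ) ha.hasFDerivAt hps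
  have hau : HasDerivAt (fun u => a (u, ξ (0, u)))
      (fderiv ℝ a (u, ξ (0, u)) (1, fderiv ℝ ξ (0, u) (0, 1))) u :=
    HasFDerivAt.comp_hasDerivAt (l := a) u ha.hasFDerivAt hpu
  have hVs : HasDerivAt (fun s => V (u, ξ (s, u)))
      (fderiv ℝ V (u, ξ (0, u)) (0, fderiv ℝ ξ (0, u) (1, 0))) 0 :=
    HasFDerivAt.comp_hasDerivAt (l := V) (0 : ℝ) hV.hasFDerivAt hps
  have h1 := ((has.clm_apply (hξss.clm_apply (hasDerivAt_const (0 : ℝ) ((0 : ℝ), (1 : ℝ))))).fun_add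
    (hηs.clm_apply hVs)).deriv
  have h2 := (hau.clm_apply (hξuu.clm_apply (hasDerivAt_const u ((1 : ℝ), (0 : ℝ))))).deriv
  -- The mixed second derivatives of `ξ` in the two terms cancel.
  have hsymm := second_fderiv_symm hξ (1, 0) (0, 1)
  simp only [map_zero, add_zero] at h1 h2
  rw [h1, h2, hsymm]
  ring

end VariationCalculus

/-- A function on a set is smooth if it is so near the points mapped to each chart domain. -/
lemma contDiffOn_of_charts {H M : Type*} [TopologicalSpace H] [TopologicalSpace M]
    [ChartedSpace H M] {P : Type*} [NormedAddCommGroup P] [NormedSpace ℝ P]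
    {F : Type*} [NormedAddCommGroup F] [NormedSpace ℝ F] {S : Set P} {X : P → M}
    (hX : ContinuousOn X S) {f : P → F}
    (hf : ∀ x₀ : M, ContDiffOn ℝ ∞ f (S ∩ X ⁻¹' (chartAt H x₀).source)) : ContDiffOn ℝ ∞ f S := by
  intro z hz
  refine (hf (X z) z ⟨hz, mem_chart_source H (X z)⟩).mono_of_mem_nhdsWithin ?_
  exact Filter.inter_mem self_mem_nhdsWithin
    (hX z hz ((chartAt H (X z)).open_source.mem_nhds (mem_chart_source H (X z))))

/-! ### Phase space points in charts -/

section PhaseCharts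

variable {E : Type*} [NormedAddCommGroup E] [NormedSpace ℝ E]
variable {M : Type*} [TopologicalSpace M] [ChartedSpace E M]

/-- The components of a covector at `x` in the preferred chart at `x₀`. -/
def covectorRep (x₀ : M) {x : M} (ζ : TangentSpace 𝓘(ℝ, E) x →L[ℝ] ℝ) : E →L[ℝ] ℝ :=
  ζ.comp (mfderiv 𝓘(ℝ, E) 𝓘(ℝ, E) (chartInv (E := E) x₀) (extChartAt 𝓘(ℝ, E) x₀ x))

lemma vectorRep_extChartAt {x₀ x : M} (hx : x ∈ (chartAt E x₀).source) (V : VField E M) :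
    vectorRep x₀ V (extChartAt 𝓘(ℝ, E) x₀ x)
      = mfderiv 𝓘(ℝ, E) 𝓘(ℝ, E) (extChartAt 𝓘(ℝ, E) x₀) x (V x) := by
  rw [vectorRep, chartInv_extChartAt hx]

variable [IsManifold 𝓘(ℝ, E) ∞ M]

attribute [local instance] isManifold_one

lemma covectorRep_mfderiv_chart {x₀ x : M} (hx : x ∈ (chartAt E x₀).source)
    (ζ : TangentSpace 𝓘(ℝ, E) x →L[ℝ] ℝ) (v : TangentSpace 𝓘(ℝ, E) x) :
    covectorRep x₀ ζ (mfderiv 𝓘(ℝ, E) 𝓘(ℝ, E) (extChartAt 𝓘(ℝ, E) x₀) x v) = ζ v := by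
  have h := mfderivWithin_extChartAt_symm_comp_mfderiv_extChartAt' (I := 𝓘(ℝ, E)) (x := x₀)
    (y := x) (by rwa [extChartAt_source])
  rw [modelWithCornersSelf_coe, range_id, mfderivWithin_univ] at h
  exact congrArg ζ (DFunLike.congr_fun h v)

lemma oneFormRep_mfderiv_extChartAt {x₀ x : M} (hx : x ∈ (chartAt E x₀).source)
    (α : OneForm E M) (v : TangentSpace 𝓘(ℝ, E) x) :
    oneFormRep x₀ α (extChartAt 𝓘(ℝ, E) x₀ x)
      (mfderiv 𝓘(ℝ, E) 𝓘(ℝ, E) (extChartAt 𝓘(ℝ, E) x₀) x v) = α x v := by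
  have h := oneFormRep_mfderiv_chart (extChartAt_mem_chartTarget hx) α
  rw [chartInv_extChartAt hx] at h
  exact h v

/-- The velocity in a chart of a map differentiable within a set. -/
lemma mfderiv_chart_mfderivWithin {X : ℝ → M} {I : Set ℝ} {u : ℝ}
    (hX : MDifferentiableWithinAt 𝓘(ℝ, ℝ) 𝓘(ℝ, E) X I u) (hu : UniqueDiffWithinAt ℝ I u) {x₀ : M}
    (hx : X u ∈ (chartAt E x₀).source) :
    mfderiv 𝓘(ℝ, E) 𝓘(ℝ, E) (extChartAt 𝓘(ℝ, E) x₀) (X u)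
        (mfderivWithin 𝓘(ℝ, ℝ) 𝓘(ℝ, E) X I u (1 : ℝ))
      = derivWithin (fun u => extChartAt 𝓘(ℝ, E) x₀ (X u)) I u := by
  have h := mfderiv_comp_mfderivWithin u (mdifferentiableAt_chart hx) hX
    (uniqueMDiffWithinAt_iff_uniqueDiffWithinAt.2 hu)
  rw [mfderivWithin_eq_fderivWithin] at h
  exact (DFunLike.congr_fun h (1 : ℝ)).symm

end PhaseCharts

/-! ### The density of the generating functional -/

section Generator

variable {E : Type*} [NormedAddCommGroup E] [NormedSpace ℝ E]
variable {M : Type*} [TopologicalSpace M] [ChartedSpace E M]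

/-- The integrand of the generating functional. -/
def generatorDensity (J : JacobiStructure E M) (lamU : ℝ → ℝ) (p : JetPath E M)
    (Z : PhasePoint E M) (u : ℝ) : ℝ :=
  (p u).1 (Z.X u) (constraintBeta J lamU Z u) + (p u).2 (Z.X u) * constraintLambda J Z u

lemma generator_congr {J : JacobiStructure E M} {lamU : ℝ → ℝ} {p q : JetPath E M}
    (h : EqOn p q (Icc 0 1)) (Z : PhasePoint E M) :
    generator J lamU p Z = generator J lamU q Z :=
  intervalIntegral.integral_congr fun u hu => by
    rw [uIcc_of_le zero_le_one] at hu
    simp only [h hu]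

variable [IsManifold 𝓘(ℝ, E) ∞ M] [FiniteDimensional ℝ E]

variable {J : JacobiStructure E M} {lamU : ℝ → ℝ} {p : JetPath E M}

lemma mfderiv_chart_sharp (J : JacobiStructure E M) {x₀ x : M} (hx : x ∈ (chartAt E x₀).source)
    (α : OneForm E M) :
    mfderiv 𝓘(ℝ, E) 𝓘(ℝ, E) (extChartAt 𝓘(ℝ, E) x₀) x (J.sharp x (α x))
      = localSharp J x₀ (extChartAt 𝓘(ℝ, E) x₀ x)
          (oneFormRep x₀ α (extChartAt 𝓘(ℝ, E) x₀ x)) :=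
  (vectorRep_extChartAt hx (J.sharpField α)).symm.trans
    (vectorRep_sharpField J α (extChartAt_mem_chartTarget hx))

lemma covectorRep_anchorRep (J : JacobiStructure E M) (P : JetSection E M) {x₀ x : M}
    (hx : x ∈ (chartAt E x₀).source) (ζ : TangentSpace 𝓘(ℝ, E) x →L[ℝ] ℝ) :
    covectorRep x₀ ζ (anchorRep J x₀ P (extChartAt 𝓘(ℝ, E) x₀ x))
      = ζ (J.sharp x (P.1 x)) + P.2 x * ζ (J.reeb x) := by
  rw [anchorRep, IsLocalJacobi.locAnchor, ← mfderiv_chart_sharp J hx, vectorRep_extChartAt hx,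
    chartInv_extChartAt hx]
  refine (map_add (covectorRep x₀ ζ) _ _).trans (congrArg₂ (· + ·) ?_ ?_)
  · exact covectorRep_mfderiv_chart hx ζ _
  · exact (map_smul (covectorRep x₀ ζ) _ _).trans
      (congrArg (P.2 x * ·) (covectorRep_mfderiv_chart hx ζ _))

/-- In a chart the integrand is `β(X') + ζ(V)`, with `V = ♯β + λ_t E`; the term with `λ_u` drops
out because of the second class constraint. -/
theorem generatorDensity_eq (hp : IsGaugeParameter J p) (Z : PhasePoint E M) {u : ℝ}
    (hu : u ∈ Icc (0 : ℝ) 1) {x₀ : M} (hx : Z.X u ∈ (chartAt E x₀).source) :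
    generatorDensity J lamU p Z u
      = oneFormRep x₀ (p u).1 (extChartAt 𝓘(ℝ, E) x₀ (Z.X u))
          (derivWithin (fun u => extChartAt 𝓘(ℝ, E) x₀ (Z.X u)) (Icc 0 1) u)
        + covectorRep x₀ (Z.ζ u) (anchorRep J x₀ (p u) (extChartAt 𝓘(ℝ, E) x₀ (Z.X u))) := by
  have hX := (Z.smooth.1 u hu).mdifferentiableWithinAt (by simp)
  rw [← mfderiv_chart_mfderivWithin hX (uniqueDiffOn_Icc zero_lt_one u hu) hx,
    oneFormRep_mfderiv_extChartAt hx, covectorRep_anchorRep J (p u) hx]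
  simp only [generatorDensity, constraintBeta, constraintLambda]
  rw [map_sub, map_sub, map_smul, hp.reeb u hu, J.sharp_skew (Z.X u) (Z.ζ u)]
  simp only [smul_eq_mul]
  ring

end Generator

/-! ### Smooth variations in charts -/

section Variations

variable {E : Type*} [NormedAddCommGroup E] [NormedSpace ℝ E]
variable {M : Type*} [TopologicalSpace M] [ChartedSpace E M]

/-- The domain `ℝ × [0, 1]` of a variation of a path. -/
abbrev strip : Set (ℝ × ℝ) := univ ×ˢ Icc (0 : ℝ) 1

lemma uniqueDiffOn_strip : UniqueDiffOn ℝ strip :=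
  uniqueDiffOn_univ.prod (uniqueDiffOn_Icc zero_lt_one)

/-- The positions of a variation, in the preferred chart at `x₀`. -/
def posRep (x₀ : M) (Γ : ℝ → PhasePoint E M) (z : ℝ × ℝ) : E :=
  extChartAt 𝓘(ℝ, E) x₀ ((Γ z.1).X z.2)

/-- The momenta of a variation, in the preferred chart at `x₀`. -/
def momRep (x₀ : M) (Γ : ℝ → PhasePoint E M) (z : ℝ × ℝ) : E →L[ℝ] ℝ :=
  covectorRep x₀ ((Γ z.1).ζ z.2)

/-- The part of the strip which is mapped to the domain of the preferred chart at `x₀`. -/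
abbrev chartStrip (x₀ : M) (Γ : ℝ → PhasePoint E M) : Set (ℝ × ℝ) :=
  strip ∩ (fun z : ℝ × ℝ => (Γ z.1).X z.2) ⁻¹' (chartAt E x₀).source

variable {Γ : ℝ → PhasePoint E M}

lemma chartStrip_mem_nhdsWithin (hΓ : IsSmoothVariation Γ) {x₀ : M} {z : ℝ × ℝ}
    (hz : z ∈ chartStrip x₀ Γ) : chartStrip x₀ Γ ∈ nhdsWithin z strip :=
  Filter.inter_mem self_mem_nhdsWithin
    (hΓ.1.continuousOn z hz.1 ((chartAt E x₀).open_source.mem_nhds hz.2))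

lemma eventually_chartStrip (hΓ : IsSmoothVariation Γ) {u : ℝ} (hu : u ∈ Ioo (0 : ℝ) 1) :
    ∀ᶠ z in nhds ((0 : ℝ), u), z ∈ chartStrip ((Γ 0).X u) Γ ∧ strip ∈ nhds z := by
  have h1 : strip ∈ nhds ((0 : ℝ), u) :=
    prod_mem_nhds Filter.univ_mem (Icc_mem_nhds hu.1 hu.2)
  have hz : ((0 : ℝ), u) ∈ chartStrip ((Γ 0).X u) Γ :=
    ⟨⟨mem_univ _, Ioo_subset_Icc_self hu⟩, mem_chart_source E ((Γ 0).X u)⟩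
  have h2 := chartStrip_mem_nhdsWithin hΓ hz
  rw [nhdsWithin_eq_nhds.2 h1] at h2
  exact Filter.Eventually.and h2 (eventually_mem_nhds_iff.2 h1)

lemma contDiffOn_momRep (hΓ : IsSmoothVariation Γ) (x₀ : M) :
    ContDiffOn ℝ ∞ (momRep x₀ Γ) (chartStrip x₀ Γ) := hΓ.2 x₀

lemma isSmoothVariation_const (Z : PhasePoint E M) : IsSmoothVariation fun _ => Z := by
  refine ⟨Z.smooth.1.comp (contMDiffOn_iff_contDiffOn.2 contDiffOn_snd) fun z hz => hz.2,
    fun x₀ => (Z.smooth.2 x₀).comp contDiffOn_snd fun z hz => ⟨hz.1.2, hz.2⟩⟩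

variable [IsManifold 𝓘(ℝ, E) ∞ M]

lemma contDiffOn_posRep (hΓ : IsSmoothVariation Γ) (x₀ : M) :
    ContDiffOn ℝ ∞ (posRep x₀ Γ) (chartStrip x₀ Γ) :=
  ((contMDiffOn_extChartAt (I := 𝓘(ℝ, E)) (n := ∞) (x := x₀)).comp
    (hΓ.1.mono inter_subset_left) fun _ hz => hz.2).contDiffOn

lemma contDiffWithinAt_posRep (hΓ : IsSmoothVariation Γ) {x₀ : M} {z : ℝ × ℝ}
    (hz : z ∈ chartStrip x₀ Γ) : ContDiffWithinAt ℝ ∞ (posRep x₀ Γ) strip z :=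
  (contDiffOn_posRep hΓ x₀ z hz).mono_of_mem_nhdsWithin (chartStrip_mem_nhdsWithin hΓ hz)

lemma contDiffOn_fderivWithin_posRep (hΓ : IsSmoothVariation Γ) (x₀ : M) :
    ContDiffOn ℝ ∞ (fderivWithin ℝ (posRep x₀ Γ) strip) (chartStrip x₀ Γ) := fun _ hz =>
  ((contDiffWithinAt_posRep hΓ hz).fderivWithin_right uniqueDiffOn_strip (m := ∞) le_rfl
    hz.1).mono inter_subset_left

/-- Restriction of a smooth function of `u` and a chart coordinate to a variation. -/
lemma contDiffOn_comp_posRep (hΓ : IsSmoothVariation Γ) {F : Type*} [NormedAddCommGroup F]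
    [NormedSpace ℝ F] {x₀ : M} {f : ℝ × E → F}
    (hf : ContDiffOn ℝ ∞ f (Icc (0 : ℝ) 1 ×ˢ chartTarget x₀)) :
    ContDiffOn ℝ ∞ (fun z : ℝ × ℝ => f (z.2, posRep x₀ Γ z)) (chartStrip x₀ Γ) :=
  hf.comp (contDiffOn_snd.prodMk (contDiffOn_posRep hΓ x₀)) fun _ hz =>
    ⟨hz.1.2, extChartAt_mem_chartTarget hz.2⟩

lemma derivWithin_posRep (hΓ : IsSmoothVariation Γ) {x₀ : M} {s u : ℝ}
    (hz : (s, u) ∈ chartStrip x₀ Γ) :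
    derivWithin (fun u => extChartAt 𝓘(ℝ, E) x₀ ((Γ s).X u)) (Icc 0 1) u
      = fderivWithin ℝ (posRep x₀ Γ) strip (s, u) (0, 1) := by
  have h1 := ((contDiffWithinAt_posRep hΓ hz).differentiableWithinAt
    (by simp)).hasFDerivWithinAt
  have h2 : HasDerivWithinAt (fun u : ℝ => (s, u)) ((0 : ℝ), (1 : ℝ)) (Icc 0 1) u :=
    ((hasDerivAt_const u s).prodMk (hasDerivAt_id u)).hasDerivWithinAt
  exact (h1.comp_hasDerivWithinAt (t := strip) u h2
    (fun _ h => mk_mem_prod (mem_univ _) h)).derivWithin (uniqueDiffOn_Icc zero_lt_one u hz.1.2)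

lemma mfderiv_chart_deltaX (hΓ : IsSmoothVariation Γ) {x₀ : M} {u : ℝ}
    (hz : (0, u) ∈ chartStrip x₀ Γ) :
    mfderiv 𝓘(ℝ, E) 𝓘(ℝ, E) (extChartAt 𝓘(ℝ, E) x₀) ((Γ 0).X u)
        (deltaX (E := E) Γ u)
      = fderivWithin ℝ (posRep x₀ Γ) strip (0, u) (1, 0) := by
  have h1 := ((contDiffWithinAt_posRep hΓ hz).differentiableWithinAt
    (by simp)).hasFDerivWithinAt
  have h2 : HasDerivWithinAt (fun s : ℝ => (s, u)) ((1 : ℝ), (0 : ℝ)) univ 0 :=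
    ((hasDerivAt_id (0 : ℝ)).prodMk (hasDerivAt_const _ u)).hasDerivWithinAt
  have h3 := (h1.comp_hasDerivWithinAt (t := strip) 0 h2
    (fun _ _ => mk_mem_prod (mem_univ _) hz.1.2)).derivWithin uniqueDiffWithinAt_univ
  have h4 : ContMDiffOn 𝓘(ℝ, ℝ) 𝓘(ℝ, E) ∞ (fun s => (Γ s).X u) univ :=
    hΓ.1.comp (f := fun s : ℝ => (s, u))
      (contMDiffOn_iff_contDiffOn.2 (contDiffOn_id.prodMk contDiffOn_const))
      fun _ _ => mk_mem_prod (mem_univ _) hz.1.2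
  have h5 := mfderiv_chart_mfderivWithin ((h4 0 (mem_univ _)).mdifferentiableWithinAt (by simp))
    uniqueDiffWithinAt_univ (x₀ := x₀) hz.2
  rw [mfderivWithin_univ] at h5
  exact h5.trans h3

/-- The boundary term `β(δX)`. -/
lemma contDiffOn_boundaryTerm {J : JacobiStructure E M} {p : JetPath E M}
    (hp : IsGaugeParameter J p) (hΓ : IsSmoothVariation Γ) :
    ContDiffOn ℝ ∞ (fun u => (p u).1 ((Γ 0).X u) (deltaX (E := E) Γ u)) (Icc 0 1) := by
  refine contDiffOn_of_charts (H := E) (M := M) (Γ 0).smooth.1.continuousOn fun x₀ => ?_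
  have h1 := (contDiffOn_comp_posRep hΓ (hp.smooth x₀).1).clm_apply
    ((contDiffOn_fderivWithin_posRep hΓ x₀).clm_apply (contDiffOn_const (c := ((1 : ℝ), (0 : ℝ)))))
  have h2 : ContDiffOn ℝ ∞ (fun u : ℝ => ((0 : ℝ), u))
      (Icc 0 1 ∩ (Γ 0).X ⁻¹' (chartAt E x₀).source) := contDiffOn_const.prodMk contDiffOn_id
  refine (h1.comp h2 fun u hu => ⟨⟨mem_univ _, hu.1⟩, hu.2⟩).congr fun u hu => ?_
  have hz : (0, u) ∈ chartStrip x₀ Γ := ⟨⟨mem_univ _, hu.1⟩, hu.2⟩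
  have h3 := oneFormRep_mfderiv_extChartAt hu.2 (p u).1 (deltaX (E := E) Γ u)
  have h4 := mfderiv_chart_deltaX hΓ hz
  exact h3.symm.trans (congrArg (oneFormRep x₀ (p u).1 (extChartAt 𝓘(ℝ, E) x₀ ((Γ 0).X u))) h4)

variable [FiniteDimensional ℝ E] {J : JacobiStructure E M} {lamU : ℝ → ℝ} {p q : JetPath E M}

lemma generatorDensity_eq_variation (hp : IsGaugeParameter J p) (hΓ : IsSmoothVariation Γ)
    {x₀ : M} {z : ℝ × ℝ} (hz : z ∈ chartStrip x₀ Γ) :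
    generatorDensity J lamU p (Γ z.1) z.2
      = oneFormRep x₀ (p z.2).1 (posRep x₀ Γ z) (fderivWithin ℝ (posRep x₀ Γ) strip z (0, 1))
        + momRep x₀ Γ z (anchorRep J x₀ (p z.2) (posRep x₀ Γ z)) := by
  rw [generatorDensity_eq hp (Γ z.1) hz.1.2 hz.2, derivWithin_posRep hΓ hz]
  rfl

/-- The integrand of the generating functional is smooth along a variation, up to the ends of the
interval. -/
theorem contDiffOn_generatorDensity (hp : IsGaugeParameter J p) (hΓ : IsSmoothVariation Γ) :
    ContDiffOn ℝ ∞ (fun z : ℝ × ℝ => generatorDensity J lamU p (Γ z.1) z.2) strip := by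
  refine contDiffOn_of_charts (H := E) (M := M) hΓ.1.continuousOn fun x₀ => ?_
  have h1 := (contDiffOn_comp_posRep hΓ (hp.smooth x₀).1).clm_apply
    ((contDiffOn_fderivWithin_posRep hΓ x₀).clm_apply (contDiffOn_const (c := ((0 : ℝ), (1 : ℝ)))))
  have h2 := (contDiffOn_momRep hΓ x₀).clm_apply
    (contDiffOn_comp_posRep hΓ (hp.contDiffOn_anchorRep x₀))
  exact (h1.add h2).congr fun z hz => generatorDensity_eq_variation hp hΓ hz

end Variations

/-! ### The Poisson bracket density in coordinates -/

section PoissonCalculus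

open VectorField

variable {E : Type*} [NormedAddCommGroup E] [NormedSpace ℝ E]

lemma fderiv_slice {F : Type*} [NormedAddCommGroup F] [NormedSpace ℝ F] {f : ℝ × E → F} {u : ℝ}
    {y : E} (hf : DifferentiableAt ℝ f (u, y)) (w : E) :
    fderiv ℝ (fun y => f (u, y)) y w = fderiv ℝ f (u, y) (0, w) := by
  have h : HasFDerivAt (fun y => f (u, y)) _ y :=
    HasFDerivAt.comp (g := f) y hf.hasFDerivAt (hasFDerivAt_prodMk_right u y)
  rw [h.fderiv]
  rfl

/-- The Poisson bracket density of two generators, computed from their functional derivatives, is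
minus the density of the generator of the bracket, up to the total derivative of `a(W)`. -/
lemma poisson_density {a b : ℝ × E → E →L[ℝ] ℝ} {V W : ℝ × E → E} {x : ℝ → E} {u : ℝ} {v : E}
    (η : E →L[ℝ] ℝ) (ha : DifferentiableAt ℝ a (u, x u)) (hb : DifferentiableAt ℝ b (u, x u))
    (hV : DifferentiableAt ℝ V (u, x u)) (hW : DifferentiableAt ℝ W (u, x u))
    (hx : HasDerivAt x v u)
    (hpair : ∀ᶠ t in nhds u, b (t, x u) (V (u, x u)) = - a (u, x u) (W (t, x u))) :
    (fderiv ℝ a (u, x u) (0, W (u, x u)) v - fderiv ℝ a (u, x u) (1, v) (W (u, x u))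
        + η (fderiv ℝ V (u, x u) (0, W (u, x u))))
      - (fderiv ℝ b (u, x u) (0, V (u, x u)) v - fderiv ℝ b (u, x u) (1, v) (V (u, x u))
        + η (fderiv ℝ W (u, x u) (0, V (u, x u))))
      = - (courantForm (fun y => V (u, y)) (fun y => W (u, y)) (fun y => a (u, y))
            (fun y => b (u, y)) (x u) v
          + η (lieBracket ℝ (fun y => V (u, y)) (fun y => W (u, y)) (x u)))
        - deriv (fun u => a (u, x u) (W (u, x u))) u := by
  have slice {F : Type _} [NormedAddCommGroup F] [NormedSpace ℝ F] {f : ℝ × E → F}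
      (hf : DifferentiableAt ℝ f (u, x u)) : DifferentiableAt ℝ (fun y => f (u, y)) (x u) :=
    DifferentiableAt.comp (g := f) (x u) hf (hasFDerivAt_prodMk_right u (x u)).differentiableAt
  have hpu : HasDerivAt (fun u => (u, x u)) ((1 : ℝ), v) u := (hasDerivAt_id u).prodMk hx
  have hau : HasDerivAt (fun u => a (u, x u)) (fderiv ℝ a (u, x u) (1, v)) u :=
    HasFDerivAt.comp_hasDerivAt (l := a) u ha.hasFDerivAt hpu
  have hWu : HasDerivAt (fun u => W (u, x u)) (fderiv ℝ W (u, x u) (1, v)) u :=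
    HasFDerivAt.comp_hasDerivAt (l := W) u hW.hasFDerivAt hpu
  have hpt : HasDerivAt (fun t => (t, x u)) ((1 : ℝ), (0 : E)) u :=
    (hasDerivAt_id u).prodMk (hasDerivAt_const u (x u))
  have hbt : HasDerivAt (fun t => b (t, x u)) (fderiv ℝ b (u, x u) (1, 0)) u :=
    HasFDerivAt.comp_hasDerivAt (l := b) u hb.hasFDerivAt hpt
  have hWt : HasDerivAt (fun t => W (t, x u)) (fderiv ℝ W (u, x u) (1, 0)) u :=
    HasFDerivAt.comp_hasDerivAt (l := W) u hW.hasFDerivAt hpt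
  -- the explicit `u`-derivatives cancel, by skew-symmetry of the pairing at different parameters
  have hcancel := Filter.EventuallyEq.deriv_eq hpair
  rw [(hbt.clm_apply (hasDerivAt_const u (V (u, x u)))).deriv,
    (((hasDerivAt_const u (a (u, x u))).clm_apply hWt).fun_neg).deriv] at hcancel
  simp only [map_zero, add_zero, zero_apply, zero_add] at hcancel
  have split {F : Type _} [NormedAddCommGroup F] [NormedSpace ℝ F] (L : ℝ × E →L[ℝ] F) :
      L (1, v) = L (1, 0) + L (0, v) := by rw [← map_add]; simp
  rw [(hau.clm_apply hWu).deriv, courantForm, sub_apply, sub_apply,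
    fderiv_pairing (slice hb) (slice hV), lieBracket_eq]
  simp only [locLie, add_apply, ContinuousLinearMap.comp_apply, fderiv_slice ha, fderiv_slice hb,
    fderiv_slice hV, fderiv_slice hW, map_sub]
  rw [split (fderiv ℝ b (u, x u)), split (fderiv ℝ W (u, x u)), add_apply, map_add]
  linarith

end PoissonCalculus

/-! ### Functional derivatives and the Poisson bracket of the generators -/

section FunctionalDerivatives

variable {E : Type*} [NormedAddCommGroup E] [NormedSpace ℝ E] [FiniteDimensional ℝ E]
variable {M : Type*} [TopologicalSpace M] [ChartedSpace E M]

/-- The functional derivative `δK/δζ = ♯β + λ_t E`. -/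
def derivZeta (J : JacobiStructure E M) (p : JetPath E M) (Z : PhasePoint E M) (u : ℝ) : E :=
  anchorRep J (Z.X u) (p u) (extChartAt 𝓘(ℝ, E) (Z.X u) (Z.X u))

/-- The functional derivative `δK/δX^i = ∂_i β_k X'^k - d/du(β_i(u, X)) + ζ_k ∂_i V^k`, with
`V = ♯β + λ_t E`, in the preferred chart at `X(u)`. -/
def derivX (J : JacobiStructure E M) (p : JetPath E M) (Z : PhasePoint E M) (u : ℝ) : E →L[ℝ] ℝ :=
  let x₀ := Z.X u
  let y : E := extChartAt 𝓘(ℝ, E) x₀ x₀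
  let v : E := derivWithin (fun u => extChartAt 𝓘(ℝ, E) x₀ (Z.X u)) (Icc 0 1) u
  let Da := fderiv ℝ (fun z : ℝ × E => oneFormRep x₀ (p z.1).1 z.2) (u, y)
  let DV := fderiv ℝ (fun z : ℝ × E => anchorRep J x₀ (p z.1) z.2) (u, y)
  (Da.comp (ContinuousLinearMap.inr ℝ ℝ E)).flip v - Da (1, v)
    + (covectorRep x₀ (Z.ζ u)).comp (DV.comp (ContinuousLinearMap.inr ℝ ℝ E))

lemma derivX_apply (J : JacobiStructure E M) (p : JetPath E M) (Z : PhasePoint E M) (u : ℝ)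
    (w : E) :
    derivX J p Z u w
      = fderiv ℝ (fun z : ℝ × E => oneFormRep (Z.X u) (p z.1).1 z.2)
            (u, extChartAt 𝓘(ℝ, E) (Z.X u) (Z.X u)) (0, w)
            (derivWithin (fun t => extChartAt 𝓘(ℝ, E) (Z.X u) (Z.X t)) (Icc 0 1) u)
        - fderiv ℝ (fun z : ℝ × E => oneFormRep (Z.X u) (p z.1).1 z.2)
            (u, extChartAt 𝓘(ℝ, E) (Z.X u) (Z.X u))
            (1, derivWithin (fun t => extChartAt 𝓘(ℝ, E) (Z.X u) (Z.X t)) (Icc 0 1) u) w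
        + covectorRep (Z.X u) (Z.ζ u)
            (fderiv ℝ (fun z : ℝ × E => anchorRep J (Z.X u) (p z.1) z.2)
              (u, extChartAt 𝓘(ℝ, E) (Z.X u) (Z.X u)) (0, w)) := rfl

variable {Γ : ℝ → PhasePoint E M}
variable [IsManifold 𝓘(ℝ, E) ∞ M] {J : JacobiStructure E M} {lamU : ℝ → ℝ} {p q : JetPath E M}

lemma Icc_prod_mem_nhds {X : Type*} [TopologicalSpace X] {U : Set X} (hU : IsOpen U) {u : ℝ}
    (hu : u ∈ Ioo (0 : ℝ) 1) {y : X} (hy : y ∈ U) : Icc (0 : ℝ) 1 ×ˢ U ∈ nhds (u, y) :=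
  prod_mem_nhds (Icc_mem_nhds hu.1 hu.2) (hU.mem_nhds hy)

/-- The first variation of the density of the generator, up to the total derivative of the
boundary term. -/
lemma variation_density (hp : IsGaugeParameter J p) (hΓ : IsSmoothVariation Γ) {u : ℝ}
    (hu : u ∈ Ioo (0 : ℝ) 1) :
    deltaZeta Γ u (derivZeta J p (Γ 0) u) + derivX J p (Γ 0) u (deltaX (E := E) Γ u)
      = deriv (fun s => generatorDensity J lamU p (Γ s) u) 0
        - deriv (fun u => (p u).1 ((Γ 0).X u) (deltaX (E := E) Γ u)) u := by
  -- Near `(0, u)` with `u` interior the strip is a neighbourhood and the variation stays in the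
  -- chart at `X(u)`, so the within-derivatives are derivatives and `first_variation` applies.
  have hev := eventually_chartStrip hΓ hu
  set x₀ := (Γ 0).X u with hx₀
  have hz : (0, u) ∈ chartStrip x₀ Γ := hev.self_of_nhds.1
  have hst : strip ∈ nhds ((0 : ℝ), u) := hev.self_of_nhds.2
  have hcs : chartStrip x₀ Γ ∈ nhds ((0 : ℝ), u) := hev.mono fun _ h => h.1
  have hU := Icc_prod_mem_nhds (isOpen_chartTarget x₀) hu (extChartAt_mem_chartTarget hz.2)
  have ha := ((hp.smooth x₀).1.contDiffAt hU).differentiableAt (by simp)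
  have hV := ((hp.contDiffOn_anchorRep x₀).contDiffAt hU).differentiableAt (by simp)
  have hξ := (contDiffOn_posRep hΓ x₀).contDiffAt hcs
  have hη := ((contDiffOn_momRep hΓ x₀).contDiffAt hcs).differentiableAt (by simp)
  have key := first_variation (ξ := posRep x₀ Γ) (η := momRep x₀ Γ) ha hV hξ hη
  have cs : Filter.Tendsto (fun s : ℝ => (s, u)) (nhds 0) (nhds ((0 : ℝ), u)) :=
    (continuous_id.prodMk continuous_const).tendsto' _ _ rfl
  have cu : Filter.Tendsto (fun t : ℝ => ((0 : ℝ), t)) (nhds u) (nhds ((0 : ℝ), u)) :=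
    (continuous_const.prodMk continuous_id).tendsto' _ _ rfl
  have e1 : (fun s => generatorDensity J lamU p (Γ s) u) =ᶠ[nhds 0] fun s =>
      oneFormRep x₀ (p u).1 (posRep x₀ Γ (s, u)) (fderiv ℝ (posRep x₀ Γ) (s, u) (0, 1))
        + momRep x₀ Γ (s, u) (anchorRep J x₀ (p u) (posRep x₀ Γ (s, u))) := by
    filter_upwards [cs.eventually hev] with s hs
    rw [generatorDensity_eq_variation (z := (s, u)) hp hΓ hs.1, fderivWithin_of_mem_nhds hs.2]
  have e2 : (fun t => (p t).1 ((Γ 0).X t) (deltaX (E := E) Γ t)) =ᶠ[nhds u] fun t =>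
      oneFormRep x₀ (p t).1 (posRep x₀ Γ (0, t)) (fderiv ℝ (posRep x₀ Γ) (0, t) (1, 0)) := by
    filter_upwards [cu.eventually hev] with t ht
    have h3 := oneFormRep_mfderiv_extChartAt ht.1.2 (p t).1 (deltaX (E := E) Γ t)
    have h4 := mfderiv_chart_deltaX hΓ ht.1
    rw [fderivWithin_of_mem_nhds ht.2] at h4
    exact h3.symm.trans (congrArg (oneFormRep x₀ (p t).1 (extChartAt 𝓘(ℝ, E) x₀ ((Γ 0).X t))) h4)
  have e3 : deltaX (E := E) Γ u = fderiv ℝ (posRep x₀ Γ) (0, u) (1, 0) := by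
    have h4 := mfderiv_chart_deltaX hΓ hz
    rw [fderivWithin_of_mem_nhds hst, ← hx₀, mfderiv_chart_self] at h4
    exact h4
  have e4 : deltaZeta Γ u = fderiv ℝ (momRep x₀ Γ) (0, u) (1, 0) := by
    have h2 : HasDerivAt (fun s : ℝ => (s, u)) ((1 : ℝ), (0 : ℝ)) 0 :=
      (hasDerivAt_id (0 : ℝ)).prodMk (hasDerivAt_const _ u)
    exact (HasFDerivAt.comp_hasDerivAt (l := momRep x₀ Γ) (0 : ℝ) hη.hasFDerivAt h2).deriv
  have e5 : derivWithin (fun t => extChartAt 𝓘(ℝ, E) x₀ ((Γ 0).X t)) (Icc 0 1) u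
      = fderiv ℝ (posRep x₀ Γ) (0, u) (0, 1) := by
    rw [derivWithin_posRep hΓ hz, fderivWithin_of_mem_nhds hst]
  rw [e1.deriv_eq, e2.deriv_eq, key, e3, e4, derivX_apply, ← hx₀, e5]
  rfl

lemma integral_deriv_eq_zero {h : ℝ → ℝ} (hh : ContDiffOn ℝ ∞ h (Icc 0 1)) (h0 : h 0 = 0)
    (h1 : h 1 = 0) :
    IntervalIntegrable (deriv h) volume 0 1 ∧ ∫ u in (0 : ℝ)..1, deriv h u = 0 := by
  refine ⟨?_, ?_⟩
  · have := (hh.derivWithin (m := 0) (uniqueDiffOn_Icc zero_lt_one) (by simp)).continuousOn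
    apply (this.intervalIntegrable_of_Icc (μ := volume) zero_le_one).congr_ae
    simp only [uIoc_of_le zero_le_one]
    rw [← Measure.restrict_congr_set Ioo_ae_eq_Ioc]
    filter_upwards [self_mem_ae_restrict measurableSet_Ioo] with x hx
    exact derivWithin_of_mem_nhds (Icc_mem_nhds hx.1 hx.2)
  · rw [intervalIntegral.integral_deriv_of_contDiffOn_Icc (hh.of_le (by simp)) zero_le_one, h0, h1,
      sub_zero]

lemma intervalIntegral_congr_Ioo {f g : ℝ → ℝ} (h : ∀ u ∈ Ioo (0 : ℝ) 1, f u = g u) :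
    (∫ u in (0 : ℝ)..1, f u = ∫ u in (0 : ℝ)..1, g u) ∧
      (IntervalIntegrable g volume 0 1 → IntervalIntegrable f volume 0 1) := by
  have hae : f =ᵐ[volume.restrict (uIoc (0 : ℝ) 1)] g := by
    rw [uIoc_of_le zero_le_one, ← Measure.restrict_congr_set Ioo_ae_eq_Ioc]
    filter_upwards [self_mem_ae_restrict measurableSet_Ioo] with x hx using h x hx
  exact ⟨intervalIntegral.integral_congr_ae_restrict hae, fun hg => hg.congr_ae hae.symm⟩

/-- The generators have functional derivatives; the boundary term vanishes because `β` does at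
the ends of the interval. -/
theorem hasFunctionalDerivAt_generator (hp : IsGaugeParameter J p) (Z : PhasePoint E M) :
    HasFunctionalDerivAt (generator J lamU p) Z (derivZeta J p Z) (derivX J p Z) := by
  intro Γ hΓ hZ
  subst hZ
  obtain ⟨hI, hD⟩ := hasDerivAt_integral_of_contDiffOn
    (contDiffOn_generatorDensity (lamU := lamU) hp hΓ)
  obtain ⟨hI', h0⟩ := integral_deriv_eq_zero (contDiffOn_boundaryTerm hp hΓ)
    (by rw [hp.left]; rfl) (by rw [hp.right]; rfl)
  obtain ⟨h1, h2⟩ := intervalIntegral_congr_Ioo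
    (fun u hu => variation_density (lamU := lamU) hp hΓ hu)
  refine ⟨h2 (hI.sub hI'), ?_⟩
  rw [h1, intervalIntegral.integral_sub hI hI', h0, sub_zero]
  exact hD

/-- The density of the Poisson bracket of two generators. -/
lemma poisson_density_generator (hp : IsGaugeParameter J p) (hq : IsGaugeParameter J q)
    (Z : PhasePoint E M) {u : ℝ} (hu : u ∈ Ioo (0 : ℝ) 1) :
    derivX J p Z u (derivZeta J q Z u) - derivX J q Z u (derivZeta J p Z u)
      = - generatorDensity J lamU (pathBracket J p q) Z u
        - deriv (fun u => J.lam (q u).1 (p u).1 (Z.X u)) u := by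
  have huI := Ioo_subset_Icc_self hu
  have hΓ := isSmoothVariation_const Z
  have hev := eventually_chartStrip hΓ hu
  have hx := mem_chart_source E (Z.X u)
  rw [generatorDensity_eq (hp.bracket hq) Z huI hx]
  simp only [derivX_apply, derivZeta]
  set x₀ := Z.X u with hx₀
  have hy := extChartAt_mem_chartTarget hx
  have hU := Icc_prod_mem_nhds (isOpen_chartTarget x₀) hu hy
  set x : ℝ → E := fun t => extChartAt 𝓘(ℝ, E) x₀ (Z.X t) with hxdef
  have hz : (0, u) ∈ chartStrip x₀ fun _ => Z := hev.self_of_nhds.1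
  have hcs : chartStrip x₀ (fun _ => Z) ∈ nhds ((0 : ℝ), u) := hev.mono fun _ h => h.1
  have hξ := ((contDiffOn_posRep hΓ x₀).contDiffAt hcs).differentiableAt (by simp)
  have hxd : DifferentiableAt ℝ x u :=
    DifferentiableAt.comp (g := posRep x₀ fun _ => Z) u hξ
      (hasFDerivAt_prodMk_right (0 : ℝ) u).differentiableAt
  have hxv : HasDerivAt x (derivWithin x (Icc 0 1) u) u := by
    rw [derivWithin_of_mem_nhds (Icc_mem_nhds hu.1 hu.2)]
    exact hxd.hasDerivAt
  have ha := ((hp.smooth x₀).1.contDiffAt hU).differentiableAt (by simp)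
  have hb := ((hq.smooth x₀).1.contDiffAt hU).differentiableAt (by simp)
  have hV := ((hp.contDiffOn_anchorRep x₀).contDiffAt hU).differentiableAt (by simp)
  have hW := ((hq.contDiffOn_anchorRep x₀).contDiffAt hU).differentiableAt (by simp)
  have key := poisson_density (x := x) (covectorRep x₀ (Z.ζ u)) ha hb hV hW hxv (by
    filter_upwards [Icc_mem_nhds hu.1 hu.2] with t ht
    exact (hp.isGaugeSection huI).pairing_skew (hq.isGaugeSection ht) hy)
  have e1 : (fun u => J.lam (q u).1 (p u).1 (Z.X u)) =ᶠ[nhds u] fun t =>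
      oneFormRep x₀ (p t).1 (x t) (anchorRep J x₀ (q t) (x t)) := by
    have cu : Filter.Tendsto (fun t : ℝ => ((0 : ℝ), t)) (nhds u) (nhds ((0 : ℝ), u)) :=
      (continuous_const.prodMk continuous_id).tendsto' _ _ rfl
    filter_upwards [cu.eventually hev] with t ht
    have hxt : Z.X t ∈ (chartAt E x₀).source := ht.1.2
    have hyt := extChartAt_mem_chartTarget hxt
    have h := lam_chartInv J (q t).1 (p t).1 hyt
    rw [chartInv_extChartAt hxt] at h
    rw [h, anchorRep,
      IsLocalJacobi.pairing_locAnchor ((hp.isGaugeSection ht.1.1.2).rep_reeb hyt)]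
  rw [e1.deriv_eq]
  have e2 : oneFormRep x₀ (pathBracket J p q u).1 (x u) = _ :=
    (hp.isGaugeSection huI).rep_bracket_fst (hq.isGaugeSection huI) hy
  have e3 : anchorRep J x₀ (pathBracket J p q u) (x u) = _ :=
    ((hp.isGaugeSection huI).lieBracket_anchorRep (hq.isGaugeSection huI) hy).symm
  have e4 : extChartAt 𝓘(ℝ, E) x₀ x₀ = x u := rfl
  rw [e4, e2, e3]
  exact key

lemma contDiffOn_lam_path (hp : IsGaugeParameter J p) (hq : IsGaugeParameter J q)
    (Z : PhasePoint E M) :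
    ContDiffOn ℝ ∞ (fun u => J.lam (q u).1 (p u).1 (Z.X u)) (Icc 0 1) := by
  refine contDiffOn_of_charts (H := E) (M := M) Z.smooth.1.continuousOn fun x₀ => ?_
  have hΓ := isSmoothVariation_const Z
  have h1 := contDiffOn_comp_posRep hΓ ((hp.smooth x₀).1.clm_apply (hq.contDiffOn_anchorRep x₀))
  have h2 : ContDiffOn ℝ ∞ (fun u : ℝ => ((0 : ℝ), u))
      (Icc 0 1 ∩ Z.X ⁻¹' (chartAt E x₀).source) := contDiffOn_const.prodMk contDiffOn_id
  refine (h1.comp h2 fun u hu => ⟨⟨mem_univ _, hu.1⟩, hu.2⟩).congr fun t ht => ?_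
  have hxt : Z.X t ∈ (chartAt E x₀).source := ht.2
  have hyt := extChartAt_mem_chartTarget hxt
  have h := lam_chartInv J (q t).1 (p t).1 hyt
  rw [chartInv_extChartAt hxt] at h
  rw [h]
  exact (IsLocalJacobi.pairing_locAnchor ((hp.isGaugeSection ht.1).rep_reeb hyt)).symm

lemma intervalIntegrable_generatorDensity (hp : IsGaugeParameter J p) (Z : PhasePoint E M) :
    IntervalIntegrable (generatorDensity J lamU p Z) volume 0 1 := by
  have h := (contDiffOn_generatorDensity (lamU := lamU) hp
    (isSmoothVariation_const Z)).continuousOn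
  have h2 : ContinuousOn (fun u : ℝ => ((0 : ℝ), u)) (Icc (0 : ℝ) 1) := by fun_prop
  exact (h.comp h2 fun u hu => ⟨mem_univ _, hu⟩).intervalIntegrable_of_Icc zero_le_one

/-- `{K_p, K_q} = -K_{[p, q]}`. -/
theorem hasPoissonBracketAt_generator (hp : IsGaugeParameter J p) (hq : IsGaugeParameter J q)
    (Z : PhasePoint E M) :
    HasPoissonBracketAt (generator J lamU p) (generator J lamU q) Z
      (- generator J lamU (pathBracket J p q) Z) := by
  obtain ⟨hI', h0⟩ := integral_deriv_eq_zero (contDiffOn_lam_path hp hq Z)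
    (by simp [JacobiStructure.lam, hp.left]) (by simp [JacobiStructure.lam, hp.right])
  have hI : IntervalIntegrable (fun u => -generatorDensity J lamU (pathBracket J p q) Z u)
      volume 0 1 := (intervalIntegrable_generatorDensity (hp.bracket hq) Z).neg
  obtain ⟨h1, h2⟩ := intervalIntegral_congr_Ioo
    (fun u hu => poisson_density_generator (lamU := lamU) hp hq Z hu)
  refine ⟨_, _, _, _, hasFunctionalDerivAt_generator hp Z, hasFunctionalDerivAt_generator hq Z,
    h2 (hI.sub hI'), ?_⟩
  have h3 : ∫ u in (0 : ℝ)..1, -generatorDensity J lamU (pathBracket J p q) Z u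
      = - generator J lamU (pathBracket J p q) Z := intervalIntegral.integral_neg
  rw [h1, intervalIntegral.integral_sub hI hI', h0, sub_zero]
  exact h3.symm

/-- The generating functional depends linearly on the gauge parameter. -/
lemma generator_smul_add (c : ℝ) (hp : IsGaugeParameter J p) (hq : IsGaugeParameter J q)
    (Z : PhasePoint E M) :
    generator J lamU (c • p + q) Z = c * generator J lamU p Z + generator J lamU q Z := by
  have hI := intervalIntegrable_generatorDensity (lamU := lamU) hp Z
  have hI' := intervalIntegrable_generatorDensity (lamU := lamU) hq Z
  have h : generatorDensity J lamU (c • p + q) Z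
      = fun u => c * generatorDensity J lamU p Z u + generatorDensity J lamU q Z u := by
    funext u
    have e1 : ((c • p + q) u).1 (Z.X u) (constraintBeta J lamU Z u)
      = c * (p u).1 (Z.X u) (constraintBeta J lamU Z u)
        + (q u).1 (Z.X u) (constraintBeta J lamU Z u) := rfl
    have e2 : ((c • p + q) u).2 (Z.X u) = c * (p u).2 (Z.X u) + (q u).2 (Z.X u) := rfl
    rw [generatorDensity, e1, e2, generatorDensity, generatorDensity]
    ring
  have e : ∀ p, generator J lamU p Z = ∫ u in (0 : ℝ)..1, generatorDensity J lamU p Z u :=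
    fun _ => rfl
  rw [e, e, e, h, intervalIntegral.integral_add (hI.const_mul c) hI',
    intervalIntegral.integral_const_mul]

end FunctionalDerivatives

end JacobiSigma

end

/-! ### The Lie algebra of generators -/

open JacobiSigma in
theorem mainTheorem2
    {E : Type*} [NormedAddCommGroup E] [NormedSpace ℝ E] [FiniteDimensional ℝ E]
    {M : Type*} [TopologicalSpace M] [T2Space M] [SecondCountableTopology M]
    [ChartedSpace E M] [IsManifold 𝓘(ℝ, E) ∞ M]
    (J : JacobiStructure E M) (lamU : ℝ → ℝ) (hlamU : ContDiffOn ℝ ∞ lamU (Icc 0 1)) :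
    -- the gauge parameters form a vector space closed under the bracket ...
    (IsGaugeParameter J (0 : JetPath E M) ∧
      (∀ p q : JetPath E M, IsGaugeParameter J p → IsGaugeParameter J q →
        IsGaugeParameter J (p + q)) ∧
      (∀ (c : ℝ) (p : JetPath E M), IsGaugeParameter J p → IsGaugeParameter J (c • p)) ∧
      (∀ p q : JetPath E M, IsGaugeParameter J p → IsGaugeParameter J q →
        IsGaugeParameter J (pathBracket J p q))) ∧
    -- ... which makes them a Lie algebra
    ((∀ (c : ℝ) (p p' q : JetPath E M), IsGaugeParameter J p → IsGaugeParameter J p' →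
        IsGaugeParameter J q →
        EqOn (pathBracket J (c • p + p') q) (c • pathBracket J p q + pathBracket J p' q)
          (Icc 0 1)) ∧
      (∀ p q : JetPath E M, IsGaugeParameter J p → IsGaugeParameter J q →
        EqOn (pathBracket J q p) (- pathBracket J p q) (Icc 0 1)) ∧
      (∀ p q r : JetPath E M, IsGaugeParameter J p → IsGaugeParameter J q →
        IsGaugeParameter J r →
        EqOn (pathBracket J p (pathBracket J q r) + pathBracket J q (pathBracket J r p)
          + pathBracket J r (pathBracket J p q)) 0 (Icc 0 1))) ∧
    -- the map to functionals on the phase space is linear ...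
    (∀ (c : ℝ) (p q : JetPath E M), IsGaugeParameter J p → IsGaugeParameter J q →
      ∀ Z : PhasePoint E M,
        generator J lamU (c • p + q) Z = c * generator J lamU p Z + generator J lamU q Z) ∧
    -- ... and takes the bracket to minus the Poisson bracket
    (∀ p q : JetPath E M, IsGaugeParameter J p → IsGaugeParameter J q →
      ∀ Z : PhasePoint E M,
        HasPoissonBracketAt (generator J lamU p) (generator J lamU q) Z
          (- generator J lamU (pathBracket J p q) Z)) ∧
    -- the special case of 1-jets of functions
    (∀ f g : M → ℝ, ContMDiff 𝓘(ℝ, E) 𝓘(ℝ, ℝ) ∞ f → ContMDiff 𝓘(ℝ, E) 𝓘(ℝ, ℝ) ∞ g →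
      kvBracket J (jet f) (jet g) = jet (jacobiBracket J f g)) ∧
    (∀ f g : ℝ → M → ℝ, IsGaugeParameter J (fun u => jet (f u)) →
      IsGaugeParameter J (fun u => jet (g u)) →
      ∀ Z : PhasePoint E M,
        HasPoissonBracketAt (generator J lamU (fun u => jet (f u)))
          (generator J lamU (fun u => jet (g u))) Z
          (- generator J lamU (fun u => jet (jacobiBracket J (f u) (g u))) Z)) := by
  refine ⟨⟨IsGaugeParameter.zero, fun _ _ hp hq => hp.add hq, fun c _ hp => hp.smul c,
      fun _ _ hp hq => hp.bracket hq⟩,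
    ⟨fun c p p' q hp hp' hq u hu => ?_, fun p q hp hq u hu => ?_,
      fun p q r hp hq hr u hu => ?_⟩,
    fun c _ _ hp hq Z => generator_smul_add c hp hq Z,
    fun _ _ hp hq Z => hasPoissonBracketAt_generator hp hq Z,
    fun f g hf hg => kvBracket_jet J (contMDiff_isSmoothFun hf) (contMDiff_isSmoothFun hg),
    fun f g hf hg Z => ?_⟩
  · have h := ((hp.isGaugeSection hu).smul c).bracket_add (hp'.isGaugeSection hu)
      (hq.isGaugeSection hu)
    rw [(hp.isGaugeSection hu).bracket_smul c (hq.isGaugeSection hu)] at h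
    exact h
  · exact (hp.isGaugeSection hu).bracket_skew (hq.isGaugeSection hu)
  · exact (hp.isGaugeSection hu).jacobi (hq.isGaugeSection hu) (hr.isGaugeSection hu)
  · rw [← generator_congr (p := pathBracket J (fun u => jet (f u)) fun u => jet (g u))
      (fun u hu => kvBracket_jet J (hf.isGaugeSection hu).fn (hg.isGaugeSection hu).fn) Z]
    exact hasPoissonBracketAt_generator hf hg Z
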